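/- All systems are finite-dimensional. A test $\mathcal T=(\sigma_{AR},O_{A'R})$ of devices with input $A$ and output $A'$ consists of a density operator $\sigma_{AR}$ of the input and a reference system $R$, and a Hermitian observable $O_{A'R}$. Its performance operator is $\Omega=\mathrm{Tr}_R[(O_{A'R}\otimes I_A)(I_{A'}\otimes\sigma_{AR})]$, its marginal input state is $\sigma_A=\mathrm{Tr}_R\,\sigma_{AR}$. A channel $\mathcal C$ (deterministic device) has score $\mathrm{Tr}[O(\mathcal C\otimes\mathcal I_R)(\sigma_{AR})]$. A quantum operation $\mathcal C$ (probabilistic device) has success probability $p_{\rm succ}=\mathrm{Tr}[\mathcal C(\sigma_A)]$ and, if $p_{\rm succ}>0$, score $\mathrm{Tr}[O(\mathcal C\otimes\mathcal I_R)(\sigma_{AR})]/p_{\rm succ}$. A measure-and-prepare operation is a map $\rho\mapsto\sum_j\mathrm{Tr}[P_j\rho]\,\rho_j$ with finitely many $P_j\ge 0$, $\sum_jP_j\le I$, and states $\rho_j$; it is a measure-and-prepare channel if $\sum_jP_j=I$. The benchmark of a test for a class of devices is the maximal score of the measure-and-prepare devices in that class. (0) For every test $\mathcal T$, the test with the same input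 state and the observable $O+\|O\|_\infty I$ has a performance operator with positive partial transpose (PPT), and it gives every channel the score in $\mathcal T$ plus the constant $\|O\|_\infty$. Let now $\mathcal T$ be a test for deterministic devices with PPT performance operator $\Omega$. The maximal score $S$ of the measure-and-prepare channels in $\mathcal T$ exists. Consider, on the states $\tau$ of $A$ such that $I_{A'}\otimes\tau$ is invertible on the support of $\Omega$ (that is, the support of $\Omega$ lies in that of $I_{A'}\otimes\tau$), the function $$f(\tau)=\sup_{\|\alpha'\|=\|\alpha\|=1}\langle\alpha'|\langle\alpha|\,(I_{A'}\otimes\tau^{-1/2})\,\Omega\,(I_{A'}\otimes\tau^{-1/2})\,|\alpha'\rangle|\alpha\rangle ,$$ inverses being taken on the support. It attains its minimum. Let $\tau_{\min}$ be any minimizer; then $f(\tau_{\min})=S$. For a purification $|\Phi\rangle_{AR'}=\sum_n\sqrt{\lambda_n}\,|\varphi_n\rangle|\psi_n\rangle$ of $\tau_{\min}$ in Schmidt form (with $(\varphi_n)$ an orthonormal basis of the space of $A$ and the $\psi_n$ with $\lambda_n\neq0$ orthonormal), the canonical test $\mathcal T'$ has input state $|\Phi\rangle\langle\Phi|$ and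 observable $$(I_{A'}\otimes\tau_{R'}^{-1/2}T^\dagger)\,\Omega^{T_A}\,(I_{A'}\otimes T\,\tau_{R'}^{-1/2}),\qquad \tau_{R'}=\mathrm{Tr}_A|\Phi\rangle\langle\Phi|,\quad T=\sum_{n:\lambda_n\ne0}|\varphi_n\rangle\langle\psi_n| ,$$ where $T_A$ is the partial transpose on $A$ in the basis $(\varphi_n)$. Such a test exists for every purification of $\tau_{\min}$, and there are purifications with $R'$ a copy of $A$. Every such test $\mathcal T'$ has the following properties. 1. $\mathcal T'$ has performance operator $\Omega$ and marginal input state $\tau_{\min}$. It assigns the same score as $\mathcal T$ to every deterministic device. 2. For every $p\in(0,1]$, the benchmark of $\mathcal T'$ for probabilistic devices with success probability exactly $p$ is equal to $S$, the deterministic benchmark of $\mathcal T$, and so is its benchmark for all probabilistic devices with nonzero success probability. Hence the benchmark does not depend on the success probability. All these maxima are attained. -/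

import Mathlib

open Matrix
open scoped Kronecker ComplexOrder

noncomputable section

namespace QuantumBenchmark

/-! Finite-dimensional quantum systems are given by finite index types: the Hilbert space of the
system `A` is spanned by the fixed orthonormal basis labelled by `A`, operators are complex
matrices, and a composite system is labelled by the product of the index types. -/

section Basics

variable {A A' R : Type*} [Fintype A] [Fintype A'] [Fintype R]

/-- Density operators. -/
def IsState (ρ : Matrix A A ℂ) : Prop := ρ.PosSemidef ∧ ρ.trace = 1

/-- Partial trace over the right factor. -/
def ptraceRight {X Y : Type*} (M : Matrix (X × R) (Y × R) ℂ) : Matrix X Y ℂ :=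
  Matrix.of fun x y => ∑ r, M (x, r) (y, r)

/-- Partial trace over the left factor. -/
def ptraceLeft {X Y : Type*} (M : Matrix (A × X) (A × Y) ℂ) : Matrix X Y ℂ :=
  Matrix.of fun x y => ∑ a, M (a, x) (a, y)

/-- `(C ⊗ id_R)(M)`: the linear map `C` acts on the first factor, block by block. -/
def applyFst {R : Type*} (C : Matrix A A ℂ →ₗ[ℂ] Matrix A' A' ℂ)
    (M : Matrix (A × R) (A × R) ℂ) : Matrix (A' × R) (A' × R) ℂ :=
  Matrix.of fun x y => C (Matrix.of fun a b => M (a, x.2) (b, y.2)) x.1 y.1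

/-- Complete positivity. -/
def IsCompletelyPositive (C : Matrix A A ℂ →ₗ[ℂ] Matrix A' A' ℂ) : Prop :=
  ∀ (k : ℕ) (M : Matrix (A × Fin k) (A × Fin k) ℂ), M.PosSemidef → (applyFst C M).PosSemidef

/-- Quantum channels (deterministic devices): completely positive trace-preserving maps. -/
def IsChannel (C : Matrix A A ℂ →ₗ[ℂ] Matrix A' A' ℂ) : Prop :=
  IsCompletelyPositive C ∧ ∀ X, (C X).trace = X.trace

/-- Measure-and-prepare channels: measure a POVM `P` on the input and, on outcome `j`, prepare
the state `ρ j`. -/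
def IsMPChannel [DecidableEq A] (C : Matrix A A ℂ →ₗ[ℂ] Matrix A' A' ℂ) : Prop :=
  ∃ (k : ℕ) (P : Fin k → Matrix A A ℂ) (ρ : Fin k → Matrix A' A' ℂ),
    (∀ j, (P j).PosSemidef) ∧ ∑ j, P j = 1 ∧ (∀ j, IsState (ρ j)) ∧
    ∀ X, C X = ∑ j, (P j * X).trace • ρ j

/-- Measure-and-prepare quantum operations (probabilistic devices): as for channels, but the measurement may also
report failure, which happens with the remaining effect `1 - ∑ j, P j`. -/
def IsMPOperation [DecidableEq A] (C : Matrix A A ℂ →ₗ[ℂ] Matrix A' A' ℂ) : Prop :=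
  ∃ (k : ℕ) (P : Fin k → Matrix A A ℂ) (ρ : Fin k → Matrix A' A' ℂ),
    (∀ j, (P j).PosSemidef) ∧ (1 - ∑ j, P j).PosSemidef ∧ (∀ j, IsState (ρ j)) ∧
    ∀ X, C X = ∑ j, (P j * X).trace • ρ j

/-- Partial transpose on the second factor, with respect to the fixed basis of `A`. -/
def partialTranspose (M : Matrix (A' × A) (A' × A) ℂ) : Matrix (A' × A) (A' × A) ℂ :=
  Matrix.of fun x y => M (x.1, y.2) (y.1, x.2)

/-- Positive partial transpose. -/
def IsPPT (M : Matrix (A' × A) (A' × A) ℂ) : Prop := (partialTranspose M).PosSemidef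

/-- The operator `|v⟩⟨w|`. -/
def ketbra {X Y : Type*} (v : X → ℂ) (w : Y → ℂ) : Matrix X Y ℂ := vecMulVec v (star w)

/-- The product numerical range functional: the supremum of `⟨α'|⟨α| M |α'⟩|α⟩` over unit
vectors `α'` and `α`. -/
def productNumericalSup (M : Matrix (A' × A) (A' × A) ℂ) : ℝ :=
  sSup {t : ℝ | ∃ (α' : EuclideanSpace ℂ A') (α : EuclideanSpace ℂ A), ‖α'‖ = 1 ∧ ‖α‖ = 1 ∧
    t = (star (fun i : A' × A => α' i.1 * α i.2) ⬝ᵥ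
      (M *ᵥ fun i : A' × A => α' i.1 * α i.2)).re}

/-- `τ ^ (-1/2)` for positive semidefinite `τ`, the inverse being taken on the support of `τ`
(the eigenvalue `0` is sent to `0`). -/
def invSqrt [DecidableEq A] (τ : Matrix A A ℂ) : Matrix A A ℂ :=
  cfc (fun x : ℝ => (Real.sqrt x)⁻¹) τ

end Basics

section Tests

/-- A test of devices with input `A` and output `A'`: the state `σ` of the input system and of a
reference system `R` that is prepared, and the observable `O` that is measured on the output and
the reference. -/
structure Test (A A' R : Type*) [Fintype A] [Fintype R] where
  σ : Matrix (A × R) (A × R) ℂ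
  O : Matrix (A' × R) (A' × R) ℂ
  isState : IsState σ
  isHermitian : O.IsHermitian

variable {A A' R : Type*} [Fintype A] [Fintype A'] [Fintype R] [DecidableEq A] [DecidableEq A']
  [DecidableEq R]

/-- The performance operator `Tr_R[(O_{A'R} ⊗ I_A)(I_{A'} ⊗ σ_{AR})]`, an operator on `A'A`. -/
def Test.performanceOp (T : Test A A' R) : Matrix (A' × A) (A' × A) ℂ :=
  ptraceRight (R := R)
    ((Matrix.of fun x y : (A' × A) × R =>
        T.O (x.1.1, x.2) (y.1.1, y.2) * (1 : Matrix A A ℂ) x.1.2 y.1.2) *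
     (Matrix.of fun x y : (A' × A) × R =>
        (1 : Matrix A' A' ℂ) x.1.1 y.1.1 * T.σ (x.1.2, x.2) (y.1.2, y.2)))

/-- The marginal input state `σ_A`. -/
def Test.marginal (T : Test A A' R) : Matrix A A ℂ := ptraceRight T.σ

/-- The average score `Tr[O (C ⊗ id_R)(σ)]` of a deterministic device. -/
def Test.detScore (T : Test A A' R) (C : Matrix A A ℂ →ₗ[ℂ] Matrix A' A' ℂ) : ℝ :=
  ((T.O * applyFst C T.σ).trace).re

/-- The probability `Tr[(C ⊗ id_R)(σ)]` that the device produces an output. -/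
def Test.successProb (T : Test A A' R) (C : Matrix A A ℂ →ₗ[ℂ] Matrix A' A' ℂ) : ℝ :=
  ((applyFst C T.σ).trace).re

/-- The average score of a probabilistic device (meaningful if the success probability is
nonzero). -/
def Test.probScore (T : Test A A' R) (C : Matrix A A ℂ →ₗ[ℂ] Matrix A' A' ℂ) : ℝ :=
  ((T.O * applyFst C T.σ).trace).re / T.successProb C

/-- The scores of the measure-and-prepare channels. Their maximum is the benchmark for
deterministic devices. -/
def Test.mpDetScores (T : Test A A' R) : Set ℝ :=
  {s | ∃ C : Matrix A A ℂ →ₗ[ℂ] Matrix A' A' ℂ, IsMPChannel C ∧ s = T.detScore C}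

/-- The scores of the measure-and-prepare operations with success probability `p`. Their maximum
is the benchmark for probabilistic devices with success probability `p`. -/
def Test.mpProbScores (T : Test A A' R) (p : ℝ) : Set ℝ :=
  {s | ∃ C : Matrix A A ℂ →ₗ[ℂ] Matrix A' A' ℂ,
    IsMPOperation C ∧ T.successProb C = p ∧ s = T.probScore C}

/-- The scores of all measure-and-prepare operations with nonzero success probability. Their
maximum is the benchmark for arbitrary probabilistic devices. -/
def Test.mpProbScoresAll (T : Test A A' R) : Set ℝ :=
  {s | ∃ C : Matrix A A ℂ →ₗ[ℂ] Matrix A' A' ℂ,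
    IsMPOperation C ∧ 0 < T.successProb C ∧ s = T.probScore C}

/-- The operator norm of an operator on the Hilbert space of a system. -/
def opNorm (M : Matrix A A ℂ) : ℝ := ‖Matrix.toEuclideanCLM (𝕜 := ℂ) M‖

/-- The test with the same input state and the observable `O + c I`. -/
def Test.shift (T : Test A A' R) (c : ℝ) : Test A A' R where
  σ := T.σ
  O := T.O + (c : ℂ) • (1 : Matrix (A' × R) (A' × R) ℂ)
  isState := T.isState
  isHermitian := T.isHermitian.add (by
    rw [Matrix.IsHermitian, conjTranspose_smul, conjTranspose_one]
    simp)

/-- The states `τ` such that `I ⊗ τ` is invertible on the support of `Ω`: the kernel of `I ⊗ τ`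
is contained in the kernel of `Ω`, that is, the support of `Ω` lies in that of `I ⊗ τ`. -/
def admissibleStates (Ω : Matrix (A' × A) (A' × A) ℂ) : Set (Matrix A A ℂ) :=
  {τ | IsState τ ∧
    ∀ v : A' × A → ℂ, ((1 : Matrix A' A' ℂ) ⊗ₖ τ) *ᵥ v = 0 → Ω *ᵥ v = 0}

/-- The function `τ ↦ Λ^⊗[(I ⊗ τ^{-1/2}) Ω (I ⊗ τ^{-1/2})]`. -/
def benchmarkFun (Ω : Matrix (A' × A) (A' × A) ℂ) (τ : Matrix A A ℂ) : ℝ :=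
  productNumericalSup
    (((1 : Matrix A' A' ℂ) ⊗ₖ invSqrt τ) * Ω * ((1 : Matrix A' A' ℂ) ⊗ₖ invSqrt τ))

/-- `τ` is a minimizer of `benchmarkFun Ω` over the admissible states. -/
def IsMinimizer (Ω : Matrix (A' × A) (A' × A) ℂ) (τ : Matrix A A ℂ) : Prop :=
  τ ∈ admissibleStates Ω ∧ ∀ τ' ∈ admissibleStates Ω, benchmarkFun Ω τ ≤ benchmarkFun Ω τ'

end Tests

section Canonical

variable {A A' R : Type*} [Fintype A] [Fintype A'] [Fintype R] [DecidableEq A] [DecidableEq A']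
  [DecidableEq R]

/-- The vector `Φ` of the composite system `AR` is a purification of `τ`. -/
def IsPurification (Φ : A × R → ℂ) (τ : Matrix A A ℂ) : Prop :=
  ptraceRight (ketbra Φ Φ) = τ

/-- A Schmidt decomposition `Φ = ∑ₙ √λₙ φₙ ⊗ ψₙ`, where `φ` is an orthonormal basis of the Hilbert
space of `A` and the `ψₙ` with `λₙ ≠ 0` are orthonormal (the other `ψₙ` play no role). -/
structure SchmidtDecomposition (Φ : A × R → ℂ) where
  lam : A → ℝ
  φ : OrthonormalBasis A ℂ (EuclideanSpace ℂ A)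
  ψ : A → EuclideanSpace ℂ R
  lam_nonneg : ∀ n, 0 ≤ lam n
  orthonormal : Orthonormal ℂ fun n : {n : A // lam n ≠ 0} => ψ n
  eq_sum : ∀ a r, Φ (a, r) = ∑ n, (Real.sqrt (lam n) : ℂ) * (φ n a * ψ n r)

/-- The partial transpose on `A` with respect to the orthonormal basis `φ`:
`∑ₘₙ (I ⊗ |φₘ⟩⟨φₙ|) Ω (I ⊗ |φₘ⟩⟨φₙ|)`. -/
def partialTransposeIn (φ : OrthonormalBasis A ℂ (EuclideanSpace ℂ A))
    (Ω : Matrix (A' × A) (A' × A) ℂ) : Matrix (A' × A) (A' × A) ℂ :=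
  ∑ m, ∑ n, ((1 : Matrix A' A' ℂ) ⊗ₖ ketbra (φ m) (φ n)) * Ω *
    ((1 : Matrix A' A' ℂ) ⊗ₖ ketbra (φ m) (φ n))

/-- The partial isometry `T_{AR} = ∑ₙ |φₙ⟩⟨ψₙ|`, the sum running over `λₙ ≠ 0`. -/
def SchmidtDecomposition.isometry {Φ : A × R → ℂ} (D : SchmidtDecomposition Φ) : Matrix A R ℂ :=
  ∑ n, if D.lam n = 0 then 0 else ketbra (D.φ n) (D.ψ n)

/-- The observable `(I ⊗ τ_R^{-1/2} T†) Ω^{T_A} (I ⊗ T τ_R^{-1/2})`, where `τ_R` is the marginal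
of `|Φ⟩⟨Φ|` on `R` and the partial transpose is taken in the Schmidt basis of `A`. -/
def canonicalObservable (Ω : Matrix (A' × A) (A' × A) ℂ) {Φ : A × R → ℂ}
    (D : SchmidtDecomposition Φ) : Matrix (A' × R) (A' × R) ℂ :=
  ((1 : Matrix A' A' ℂ) ⊗ₖ (invSqrt (ptraceLeft (ketbra Φ Φ)) * D.isometryᴴ)) *
    partialTransposeIn D.φ Ω *
    ((1 : Matrix A' A' ℂ) ⊗ₖ (D.isometry * invSqrt (ptraceLeft (ketbra Φ Φ))))

/-- `T` is the canonical test for the pair `(Ω, τ)` built on the purification `Φ` of `τ`. -/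
def Test.IsCanonical (T : Test A A' R) (Ω : Matrix (A' × A) (A' × A) ℂ) (τ : Matrix A A ℂ)
    (Φ : A × R → ℂ) : Prop :=
  IsPurification Φ τ ∧ T.σ = ketbra Φ Φ ∧
    ∃ D : SchmidtDecomposition Φ, T.O = canonicalObservable Ω D

end Canonical

end QuantumBenchmark

end

noncomputable section

namespace QuantumBenchmark

set_option linter.unusedSectionVars false

/-! ### Compactness of convex hulls -/

section Compactness

/-! A score depends on a test only through its performance operator Ω (`Test.trace_mul_applyFst`),
and a measure-and-prepare map with effects P_j and states ρ_j scores ∑ Tr[Ω (ρ_j ⊗ P_j)]. Maximizing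
this over POVMs is a conic program. Its dual minimizes Tr Y over the Y that dominate Ω on product
vectors: ⟨u|⟨v|Ω|u⟩|v⟩ ≤ ‖u‖² ⟨v|Y|v⟩. Weak duality follows from rank-one decompositions, strong
duality from separating a point from a compact convex set (`exists_measurePrepare_and_dominates`).

If Ω is PPT, its product expectations are nonnegative. Dual candidates are then positive
semidefinite and an optimal Y of trace S exists (`exists_posSemidef_dominates_trace_le`). Write Y =
S τ with a state τ. Domination by c τ is essentially the bound f(τ) ≤ c: an admissible τ makes f(τ)
τ dominate Ω (`dominates_benchmarkFun`), so weak duality gives S ≤ f(τ). Conversely, if S τ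
dominates Ω, then PPT makes τ admissible and f(τ) ≤ S. Hence min f = S, and S τ dominates Ω for
every minimizer τ.

The canonical test has performance operator Ω and marginal τ (`Test.IsCanonical.performanceOp_eq`).
An operation with effects P_j has unnormalized score at most Tr[S τ ∑ P_j], which is S times its
success probability, so conditioning on success cannot beat S. Scaling an optimal POVM by p attains
S at success probability p. -/

theorem isCompact_convexHull {E : Type*} [NormedAddCommGroup E] [NormedSpace ℝ E]
    [FiniteDimensional ℝ E] {s : Set E} (hs : IsCompact s) : IsCompact (convexHull ℝ s) := by
  rcases s.eq_empty_or_nonempty with rfl | ⟨x₀, hx₀⟩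
  · simp
  set N := Module.finrank ℝ E + 1 with hN
  -- Carathéodory: `finrank + 1` points suffice, so the hull is a continuous image of a compact set.
  -- Shorter combinations are padded with weight 0 at the point `x₀`.
  have himage : convexHull ℝ s = (fun q : (Fin N → ℝ) × (Fin N → E) => ∑ i, q.1 i • q.2 i) ''
      (stdSimplex ℝ (Fin N) ×ˢ Set.pi Set.univ fun _ => s) := by
    ext x
    constructor
    · intro hx
      obtain ⟨ι, hι, z, w, hz, hind, hw, hw1, rfl⟩ := eq_pos_convex_span_of_mem_convexHull hx
      have hcard : Fintype.card ι ≤ Fintype.card (Fin N) := by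
        simpa [hN] using hind.card_le_finrank_succ.trans
          (Nat.succ_le_succ (Submodule.finrank_le _))
      obtain ⟨e⟩ := Function.Embedding.nonempty_of_card_le hcard
      refine ⟨(Function.extend e w 0, Function.extend e z fun _ => x₀), ⟨⟨fun i => ?_, ?_⟩,
        fun i _ => ?_⟩, ?_⟩
      · change 0 ≤ Function.extend e w 0 i
        by_cases hi : ∃ j, e j = i
        · obtain ⟨j, rfl⟩ := hi
          rw [e.injective.extend_apply]
          exact (hw j).le
        · rw [Function.extend_apply' _ _ _ hi]
          rfl
      · change ∑ i, Function.extend e w 0 i = 1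
        rw [← hw1]
        refine (Fintype.sum_of_injective e e.injective _ _ (fun i hi => ?_) fun j => ?_).symm
        · rw [Function.extend_apply' _ _ _ hi]
          rfl
        · rw [e.injective.extend_apply]
      · change Function.extend e z (fun _ => x₀) i ∈ s
        by_cases hi : ∃ j, e j = i
        · obtain ⟨j, rfl⟩ := hi
          rw [e.injective.extend_apply]
          exact hz ⟨j, rfl⟩
        · rw [Function.extend_apply' _ _ _ hi]
          exact hx₀
      · change ∑ i, Function.extend e w 0 i • Function.extend e z (fun _ => x₀) i = _
        refine (Fintype.sum_of_injective e e.injective _ _ (fun i hi => ?_) fun j => ?_).symm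
        · rw [Function.extend_apply' _ _ _ hi]
          simp
        · rw [e.injective.extend_apply, e.injective.extend_apply]
    · rintro ⟨q, ⟨hw, hz⟩, rfl⟩
      exact (convex_convexHull ℝ s).sum_mem (fun i _ => hw.1 i) hw.2
        fun i _ => subset_convexHull ℝ s (hz i trivial)
  rw [himage]
  exact ((isCompact_stdSimplex ℝ (Fin N)).prod (isCompact_univ_pi fun _ => hs)).image (by fun_prop)

end Compactness

/-! ### Rank-one decompositions of positive matrices -/

section PosSemidef

variable {n m : Type*} [Fintype n] [Fintype m]

theorem exists_conjTranspose_mul_self [DecidableEq n] {M : Matrix n n ℂ} (hM : M.PosSemidef) :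
    ∃ B : Matrix n n ℂ, M = Bᴴ * B := by
  open scoped MatrixOrder in
  exact CStarAlgebra.nonneg_iff_eq_star_mul_self.mp (Matrix.nonneg_iff_posSemidef.mpr hM)

theorem exists_sum_ketbra [DecidableEq n] {M : Matrix n n ℂ} (hM : M.PosSemidef) :
    ∃ u : n → n → ℂ, M = ∑ k, ketbra (u k) (u k) := by
  obtain ⟨B, rfl⟩ := exists_conjTranspose_mul_self hM
  refine ⟨fun k i => star (B k i), ?_⟩
  ext i j
  simp [Matrix.mul_apply, Matrix.sum_apply, ketbra, vecMulVec_apply]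

theorem posSemidef_ketbra (v : n → ℂ) : (ketbra v v).PosSemidef :=
  posSemidef_vecMulVec_self_star v

theorem trace_mul_ketbra (M : Matrix n n ℂ) (v w : n → ℂ) :
    (M * ketbra v w).trace = star w ⬝ᵥ M *ᵥ v := by
  simp only [Matrix.trace, Matrix.diag, Matrix.mul_apply, ketbra, vecMulVec_apply, dotProduct,
    mulVec, Finset.mul_sum, Pi.star_apply]
  exact Finset.sum_congr rfl fun i _ => Finset.sum_congr rfl fun j _ => by ring

theorem posSemidef_of_re_nonneg {M : Matrix n n ℂ} (hM : M.IsHermitian)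
    (h : ∀ v, 0 ≤ (star v ⬝ᵥ M *ᵥ v).re) : M.PosSemidef := by
  refine PosSemidef.of_dotProduct_mulVec_nonneg hM fun v => ?_
  rw [Complex.le_def]
  exact ⟨h v, (hM.im_star_dotProduct_mulVec_self v).symm⟩

end PosSemidef

/-! ### Scores through the performance operator -/

section Performance

variable {A A' R : Type*} [Fintype A] [Fintype A'] [Fintype R] [DecidableEq A] [DecidableEq A']
  [DecidableEq R]

theorem Test.performanceOp_apply (T : Test A A' R) (x y : A' × A) :
    T.performanceOp x y =
      ∑ r, ∑ s, T.O (x.1, r) (y.1, s) * T.σ (x.2, s) (y.2, r) := by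
  simp only [Test.performanceOp, ptraceRight, Matrix.mul_apply, Matrix.of_apply,
    Fintype.sum_prod_type, Matrix.one_apply]
  refine Finset.sum_congr rfl fun r _ => ?_
  rw [Finset.sum_eq_single y.1]
  · rw [Finset.sum_eq_single x.2]
    · simp
    · intro b _ hb
      simp [Ne.symm hb]
    · simp
  · intro b _ hb
    simp [hb]
  · simp

theorem Test.isHermitian_performanceOp (T : Test A A' R) : T.performanceOp.IsHermitian := by
  ext x y
  rw [conjTranspose_apply, T.performanceOp_apply, T.performanceOp_apply]
  simp only [star_sum, star_mul']
  rw [Finset.sum_comm]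
  refine Finset.sum_congr rfl fun r _ => Finset.sum_congr rfl fun s _ => ?_
  rw [T.isHermitian.apply, T.isState.1.isHermitian.apply]

/-- The score of a linear map in terms of a performance operator. -/
def choiScore (Ω : Matrix (A' × A) (A' × A) ℂ) (C : Matrix A A ℂ →ₗ[ℂ] Matrix A' A' ℂ) : ℂ :=
  ∑ x, ∑ y, Ω x y * C (Matrix.single x.2 y.2 1) y.1 x.1

theorem apply_eq_sum_single (C : Matrix A A ℂ →ₗ[ℂ] Matrix A' A' ℂ) (X : Matrix A A ℂ)
    (i j : A') : C X i j = ∑ a, ∑ b, X a b * C (Matrix.single a b 1) i j := by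
  conv_lhs => rw [Matrix.matrix_eq_sum_single X]
  simp only [map_sum, Matrix.sum_apply]
  refine Finset.sum_congr rfl fun a _ => Finset.sum_congr rfl fun b _ => ?_
  have h : Matrix.single a b (X a b) = X a b • Matrix.single a b (1 : ℂ) := by
    simp [Matrix.smul_single]
  rw [h, map_smul, Matrix.smul_apply, smul_eq_mul]

/-- Once `C` is expanded over matrix units, the reference indices occur only in `O` and `σ`, and
contracting them leaves Ω. Tests with equal performance operators therefore agree on all linear
maps, whatever their reference systems. -/
theorem Test.trace_mul_applyFst (T : Test A A' R) (C : Matrix A A ℂ →ₗ[ℂ] Matrix A' A' ℂ) :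
    (T.O * applyFst C T.σ).trace = choiScore T.performanceOp C := by
  simp only [choiScore, T.performanceOp_apply, Matrix.trace, Matrix.diag, Matrix.mul_apply,
    applyFst, Matrix.of_apply, Fintype.sum_prod_type]
  simp_rw [apply_eq_sum_single C (Matrix.of _), Matrix.of_apply, Finset.mul_sum, Finset.sum_mul]
  refine Finset.sum_congr rfl fun a' _ => ?_
  calc _ = ∑ r, ∑ b', ∑ a, ∑ s, ∑ b, T.O (a', r) (b', s) *
        (T.σ (a, s) (b, r) * C (Matrix.single a b 1) b' a') := by
        refine Finset.sum_congr rfl fun r _ => Finset.sum_congr rfl fun b' _ => ?_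
        exact Finset.sum_comm
    _ = ∑ a, ∑ r, ∑ b', ∑ b, ∑ s, T.O (a', r) (b', s) *
        (T.σ (a, s) (b, r) * C (Matrix.single a b 1) b' a') := by
        rw [Finset.sum_comm' (s := Finset.univ (α := A)) (t := fun _ => Finset.univ (α := R))
          (t' := Finset.univ (α := R)) (s' := fun _ => Finset.univ (α := A)) (by simp)]
        refine Finset.sum_congr rfl fun r _ => ?_
        rw [Finset.sum_comm]
        refine Finset.sum_congr rfl fun a _ => Finset.sum_congr rfl fun b' _ => ?_
        exact Finset.sum_comm
    _ = _ := by
        refine Finset.sum_congr rfl fun a _ => ?_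
        rw [Finset.sum_comm]
        refine Finset.sum_congr rfl fun b' _ => ?_
        rw [Finset.sum_comm]
        refine Finset.sum_congr rfl fun b _ => Finset.sum_congr rfl fun r _ =>
          Finset.sum_congr rfl fun s _ => by ring

theorem Test.detScore_eq (T : Test A A' R) (C : Matrix A A ℂ →ₗ[ℂ] Matrix A' A' ℂ) :
    T.detScore C = (choiScore T.performanceOp C).re := by
  rw [Test.detScore, T.trace_mul_applyFst]

theorem Test.probScore_eq (T : Test A A' R) (C : Matrix A A ℂ →ₗ[ℂ] Matrix A' A' ℂ) :
    T.probScore C = (choiScore T.performanceOp C).re / T.successProb C := by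
  rw [Test.probScore, T.trace_mul_applyFst]

theorem trace_applyFst (C : Matrix A A ℂ →ₗ[ℂ] Matrix A' A' ℂ) (M : Matrix (A × R) (A × R) ℂ) :
    (applyFst C M).trace = (C (ptraceRight M)).trace := by
  have h : ptraceRight M = ∑ r, Matrix.of fun a b => M (a, r) (b, r) := by
    ext a b
    simp [ptraceRight, Matrix.sum_apply]
  rw [h, map_sum, Matrix.trace_sum, Matrix.trace, Fintype.sum_prod_type_right]
  rfl

theorem trace_ptraceRight (M : Matrix (A × R) (A × R) ℂ) : (ptraceRight M).trace = M.trace := by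
  simp [Matrix.trace, ptraceRight, Fintype.sum_prod_type]

theorem Test.successProb_eq (T : Test A A' R) (C : Matrix A A ℂ →ₗ[ℂ] Matrix A' A' ℂ) :
    T.successProb C = ((C T.marginal).trace).re := by
  rw [Test.successProb, trace_applyFst, Test.marginal]

/-- Tr[P |a⟩⟨b|] is the (b, a) entry of P, which matches the index order of `choiScore`; hence no
transpose appears on the separable operator. -/
theorem choiScore_measurePrepare (Ω : Matrix (A' × A) (A' × A) ℂ)
    (C : Matrix A A ℂ →ₗ[ℂ] Matrix A' A' ℂ) {k : ℕ} (P : Fin k → Matrix A A ℂ)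
    (ρ : Fin k → Matrix A' A' ℂ) (hC : ∀ X, C X = ∑ j, (P j * X).trace • ρ j) :
    choiScore Ω C = ∑ j, (Ω * (ρ j ⊗ₖ P j)).trace := by
  have h : ∀ x y : A' × A,
      C (Matrix.single x.2 y.2 1) y.1 x.1 = ∑ j, (ρ j ⊗ₖ P j) y x := by
    intro x y
    rw [hC, Matrix.sum_apply]
    refine Finset.sum_congr rfl fun j _ => ?_
    rw [Matrix.smul_apply, smul_eq_mul, kroneckerMap_apply, Matrix.trace_mul_single, mul_comm]
    simp
  simp only [choiScore, h, Finset.mul_sum, Matrix.trace, Matrix.diag, Matrix.mul_apply]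
  rw [Finset.sum_comm' (s := Finset.univ (α := Fin k)) (t := fun _ => Finset.univ (α := A' × A))
          (t' := Finset.univ (α := A' × A)) (s' := fun _ => Finset.univ (α := Fin k)) (by simp)]
  refine Finset.sum_congr rfl fun x _ => Finset.sum_comm

end Performance

/-! ### Product vectors, domination and weak duality -/

section ProductForm

variable {A A' : Type*} [Fintype A] [Fintype A'] [DecidableEq A] [DecidableEq A']

/-- The product vector `u ⊗ v`. -/
def prodVec (u : A' → ℂ) (v : A → ℂ) : A' × A → ℂ := fun i => u i.1 * v i.2

/-- The quadratic form `⟨u|⟨v| Ω |u⟩|v⟩`. -/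
def prodForm (Ω : Matrix (A' × A) (A' × A) ℂ) (u : A' → ℂ) (v : A → ℂ) : ℝ :=
  (star (prodVec u v) ⬝ᵥ Ω *ᵥ prodVec u v).re

/-- `⟨u|Ω|u⟩ ≤ ‖u‖² Y` for all vectors `u` of `A'`, as quadratic forms on `A`. -/
def Dominates (Y : Matrix A A ℂ) (Ω : Matrix (A' × A) (A' × A) ℂ) : Prop :=
  ∀ u v, prodForm Ω u v ≤ (star u ⬝ᵥ u).re * (star v ⬝ᵥ Y *ᵥ v).re

theorem ketbra_prodVec (u : A' → ℂ) (v : A → ℂ) :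
    ketbra (prodVec u v) (prodVec u v) = ketbra u u ⊗ₖ ketbra v v := by
  ext x y
  simp only [ketbra, vecMulVec_apply, prodVec, kroneckerMap_apply, Pi.star_apply, star_mul']
  ring

theorem prodForm_eq_trace (Ω : Matrix (A' × A) (A' × A) ℂ) (u : A' → ℂ) (v : A → ℂ) :
    prodForm Ω u v = ((Ω * (ketbra u u ⊗ₖ ketbra v v)).trace).re := by
  rw [← ketbra_prodVec, trace_mul_ketbra, prodForm]

theorem re_star_smul_dotProduct {n : Type*} [Fintype n] (M : Matrix n n ℂ) (c : ℂ) (w : n → ℂ) :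
    (star (c • w) ⬝ᵥ M *ᵥ (c • w)).re = ‖c‖ ^ 2 * (star w ⬝ᵥ M *ᵥ w).re := by
  rw [star_smul, mulVec_smul, smul_dotProduct, dotProduct_smul, smul_smul, smul_eq_mul,
    Complex.star_def, ← Complex.normSq_eq_conj_mul_self, Complex.re_ofReal_mul,
    Complex.normSq_eq_norm_sq]

theorem prodForm_smul (Ω : Matrix (A' × A) (A' × A) ℂ) (c d : ℂ) (u : A' → ℂ) (v : A → ℂ) :
    prodForm Ω (c • u) (d • v) = ‖c‖ ^ 2 * ‖d‖ ^ 2 * prodForm Ω u v := by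
  have h : prodVec (c • u) (d • v) = (c * d) • prodVec u v := by
    ext i
    simp only [prodVec, Pi.smul_apply, smul_eq_mul]
    ring
  rw [prodForm, h, re_star_smul_dotProduct, norm_mul, mul_pow, prodForm]

theorem re_star_dotProduct_self {n : Type*} [Fintype n] (w : EuclideanSpace ℂ n) :
    (star (w : n → ℂ) ⬝ᵥ w).re = ‖w‖ ^ 2 := by
  rw [EuclideanSpace.norm_sq_eq, dotProduct, Complex.re_sum]
  refine Finset.sum_congr rfl fun i _ => ?_
  rw [Pi.star_apply, Complex.star_def, ← Complex.normSq_eq_conj_mul_self, Complex.ofReal_re,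
    Complex.normSq_eq_norm_sq]

theorem dominates_of_forall_unit {Y : Matrix A A ℂ} {Ω : Matrix (A' × A) (A' × A) ℂ}
    (h : ∀ (u : EuclideanSpace ℂ A') (v : EuclideanSpace ℂ A), ‖u‖ = 1 → ‖v‖ = 1 →
      prodForm Ω u v ≤ (star (v : A → ℂ) ⬝ᵥ Y *ᵥ v).re) : Dominates Y Ω := by
  intro u v
  by_cases hu : u = 0
  · subst hu
    have := prodForm_smul Ω 0 1 (0 : A' → ℂ) v
    simp_all
  by_cases hv : v = 0
  · subst hv
    have := prodForm_smul Ω 1 0 u (0 : A → ℂ)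
    simp_all
  set x : EuclideanSpace ℂ A' := WithLp.toLp 2 u with hx
  set y : EuclideanSpace ℂ A := WithLp.toLp 2 v with hy
  have hx0 : ‖x‖ ≠ 0 := by simpa [hx] using hu
  have hy0 : ‖y‖ ≠ 0 := by simpa [hy] using hv
  have hxu : u = (‖x‖ : ℂ) • ((‖x‖⁻¹ : ℂ) • x : EuclideanSpace ℂ A').ofLp := by
    rw [WithLp.ofLp_smul, smul_smul, mul_inv_cancel₀ (by exact_mod_cast hx0), one_smul]
  have hyv : v = (‖y‖ : ℂ) • ((‖y‖⁻¹ : ℂ) • y : EuclideanSpace ℂ A).ofLp := by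
    rw [WithLp.ofLp_smul, smul_smul, mul_inv_cancel₀ (by exact_mod_cast hy0), one_smul]
  have key := h ((‖x‖⁻¹ : ℂ) • x) ((‖y‖⁻¹ : ℂ) • y)
    (by rw [norm_smul]; simp [hx0]) (by rw [norm_smul]; simp [hy0])
  have hnorm : (star u ⬝ᵥ u).re = ‖x‖ ^ 2 := re_star_dotProduct_self x
  rw [hnorm]
  conv_lhs => rw [hxu, hyv, prodForm_smul]
  conv_rhs => rw [hyv, re_star_smul_dotProduct]
  simp only [Complex.norm_real, norm_norm]
  rw [mul_assoc]
  gcongr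

/-- Weak duality. -/
theorem Dominates.trace_mul_kronecker_le {Y : Matrix A A ℂ} {Ω : Matrix (A' × A) (A' × A) ℂ}
    (h : Dominates Y Ω) {ρ : Matrix A' A' ℂ} {P : Matrix A A ℂ} (hρ : ρ.PosSemidef)
    (hP : P.PosSemidef) :
    ((Ω * (ρ ⊗ₖ P)).trace).re ≤ (ρ.trace).re * ((Y * P).trace).re := by
  -- Both sides are bilinear in (ρ, P), so rank-one terms suffice, and for those the claim is
  -- domination itself.
  obtain ⟨u, rfl⟩ := exists_sum_ketbra hρ
  obtain ⟨w, rfl⟩ := exists_sum_ketbra hP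
  have hk : (∑ k, ketbra (u k) (u k)) ⊗ₖ (∑ l, ketbra (w l) (w l)) =
      ∑ k, ∑ l, ketbra (u k) (u k) ⊗ₖ ketbra (w l) (w l) := by
    ext x y
    simp [Matrix.sum_apply, kroneckerMap_apply, Finset.sum_mul_sum]
  rw [hk]
  simp only [Matrix.mul_sum, Matrix.trace_sum, Complex.re_sum, ← prodForm_eq_trace]
  rw [Finset.sum_mul_sum]
  refine Finset.sum_le_sum fun k _ => Finset.sum_le_sum fun l _ => ?_
  have h1 : (ketbra (u k) (u k)).trace = star (u k) ⬝ᵥ u k := by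
    rw [ketbra, trace_vecMulVec, dotProduct_comm]
  rw [trace_mul_ketbra, h1]
  exact h _ _

/-- Turns a separating functional into a Hermitian matrix. The values of `g` at E_ab and i E_ab
determine a matrix `Z₀`; against Hermitian arguments only its Hermitian part contributes. -/
theorem exists_isHermitian_forall_eq_re_trace (g : Matrix A A ℂ →ₗ[ℝ] ℝ) :
    ∃ Z : Matrix A A ℂ, Z.IsHermitian ∧ ∀ X, X.IsHermitian → g X = ((Z * X).trace).re := by
  let Z₀ : Matrix A A ℂ := Matrix.of fun b a =>
    (g (Matrix.single a b 1) : ℂ) - Complex.I * g (Matrix.single a b Complex.I)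
  have h₀ : ∀ X, g X = ((Z₀ * X).trace).re := by
    intro X
    conv_lhs => rw [Matrix.matrix_eq_sum_single X]
    rw [trace_mul_comm]
    simp only [map_sum, Matrix.trace, Matrix.diag, Matrix.mul_apply, Complex.re_sum]
    refine Finset.sum_congr rfl fun a _ => Finset.sum_congr rfl fun b _ => ?_
    have h : Matrix.single a b (X a b) = (X a b).re • Matrix.single a b (1 : ℂ) +
        (X a b).im • Matrix.single a b Complex.I := by
      rw [Matrix.smul_single, Matrix.smul_single, ← Matrix.single_add]
      congr 1
      simp [Complex.re_add_im]
    rw [h, map_add, map_smul, map_smul]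
    simp [Z₀]
  refine ⟨(2⁻¹ : ℝ) • (Z₀ + Z₀ᴴ), ?_, fun X hX => ?_⟩
  · rw [Matrix.IsHermitian, conjTranspose_smul, conjTranspose_add, conjTranspose_conjTranspose,
      add_comm, star_trivial]
  · have h1 : ((Z₀ᴴ * X).trace).re = ((Z₀ * X).trace).re := by
      have h2 : Z₀ᴴ * X = (X * Z₀)ᴴ := by rw [conjTranspose_mul, hX.eq]
      rw [h2, trace_conjTranspose, trace_mul_comm]
      simp
    rw [smul_mul_assoc, trace_smul, Complex.smul_re, add_mul, trace_add, Complex.add_re, h1, h₀ X,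
      smul_eq_mul]
    ring

end ProductForm

/-! ### Strong duality by separation -/

section Duality

attribute [local instance] Matrix.normedAddCommGroup Matrix.normedSpace

variable {A A' : Type*} [Fintype A] [Fintype A'] [DecidableEq A] [DecidableEq A']

/-- The pairs `(|v⟩⟨v|, ⟨u|⟨v| Ω |u⟩|v⟩)` for unit vectors `u` and `v`. -/
def pureProductPoints (Ω : Matrix (A' × A) (A' × A) ℂ) : Set (Matrix A A ℂ × ℝ) :=
  (fun p : EuclideanSpace ℂ A' × EuclideanSpace ℂ A =>
    (ketbra (p.2 : A → ℂ) p.2, prodForm Ω p.1 p.2)) ''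
    (Metric.sphere 0 1 ×ˢ Metric.sphere 0 1)

theorem isCompact_pureProductPoints (Ω : Matrix (A' × A) (A' × A) ℂ) :
    IsCompact (pureProductPoints Ω) := by
  refine ((isCompact_sphere _ _).prod (isCompact_sphere _ _)).image (.prodMk ?_ ?_)
  · refine continuous_matrix fun i j => ?_
    simp only [ketbra, vecMulVec_apply, Pi.star_apply]
    fun_prop
  · simp only [prodForm, dotProduct, mulVec, prodVec, Pi.star_apply]
    fun_prop

theorem isState_ketbra (u : EuclideanSpace ℂ A) (hu : ‖u‖ = 1) :
    IsState (ketbra (u : A → ℂ) u) := by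
  refine ⟨posSemidef_ketbra _, ?_⟩
  rw [ketbra, trace_vecMulVec, dotProduct_comm]
  apply Complex.ext
  · rw [re_star_dotProduct_self, hu]
    simp
  · have := (isHermitian_one (n := A) (α := ℂ)).im_star_dotProduct_mulVec_self u
    simpa using this

/-- Strong duality between measure-and-prepare strategies and dominating operators. -/
theorem exists_measurePrepare_and_dominates [Nonempty A] [Nonempty A']
    (Ω : Matrix (A' × A) (A' × A) ℂ) :
    ∃ S : ℝ, (∃ (k : ℕ) (P : Fin k → Matrix A A ℂ) (ρ : Fin k → Matrix A' A' ℂ),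
        (∀ j, (P j).PosSemidef) ∧ ∑ j, P j = 1 ∧ (∀ j, IsState (ρ j)) ∧
        (∑ j, (Ω * (ρ j ⊗ₖ P j)).trace).re = S) ∧
      ∀ s, S < s → ∃ Y : Matrix A A ℂ, Y.IsHermitian ∧ Dominates Y Ω ∧ (Y.trace).re < s := by
  set d : ℝ := (Fintype.card A : ℝ) with hd
  have hd0 : 0 < d := by
    rw [hd]
    exact_mod_cast Fintype.card_pos
  set K := convexHull ℝ (pureProductPoints Ω) with hK
  have hKc : IsCompact K := isCompact_convexHull (isCompact_pureProductPoints Ω)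
  obtain ⟨a'⟩ := ‹Nonempty A'›
  -- A POVM of rank-one effects, rescaled by 1/d, is a convex combination of pure states averaging
  -- to 1/d. The primal optimum is thus d times the height of K above this point.
  set I₀ : Matrix A A ℂ := d⁻¹ • 1 with hI₀
  have hne : (K ∩ Prod.fst ⁻¹' {I₀}).Nonempty := by
    refine ⟨∑ a : A, d⁻¹ • (ketbra (EuclideanSpace.single a (1 : ℂ)).ofLp
      (EuclideanSpace.single a (1 : ℂ)).ofLp, prodForm Ω (EuclideanSpace.single a' (1 : ℂ)).ofLp
      (EuclideanSpace.single a (1 : ℂ)).ofLp), ?_, ?_⟩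
    · refine (convex_convexHull ℝ _).sum_mem (fun _ _ => by positivity) ?_ fun a _ =>
        subset_convexHull ℝ _ ⟨(EuclideanSpace.single a' 1, EuclideanSpace.single a 1), ?_, rfl⟩
      · simp [← hd, hd0.ne']
      · simp
    · simp only [Set.mem_preimage, Set.mem_singleton_iff, Prod.fst_sum, Prod.smul_fst, hI₀]
      rw [← Finset.smul_sum]
      congr 1
      ext i j
      simp [Matrix.sum_apply, ketbra, vecMulVec_apply, Matrix.one_apply, Pi.single_apply]
  obtain ⟨⟨X, t₀⟩, ⟨hxK, hx1⟩, hmax⟩ := (hKc.inter_right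
    (isClosed_singleton.preimage continuous_fst)).exists_isMaxOn hne continuous_snd.continuousOn
  obtain rfl : X = I₀ := hx1
  refine ⟨d * t₀, ?_, fun s hs => ?_⟩
  · obtain ⟨ι, hι, w, z, hw, -, hz, hsum⟩ := mem_convexHull_iff_exists_fintype.mp hxK
    choose q hq hqz using hz
    let e := Fintype.equivFin ι
    refine ⟨Fintype.card ι, fun j => (d * w (e.symm j)) •
      ketbra (q (e.symm j)).2.ofLp (q (e.symm j)).2.ofLp,
      fun j => ketbra (q (e.symm j)).1.ofLp (q (e.symm j)).1.ofLp, fun j => ?_, ?_, fun j => ?_, ?_⟩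
    · have h : (0 : ℂ) ≤ ((d * w (e.symm j) : ℝ) : ℂ) := by
        exact_mod_cast mul_nonneg hd0.le (hw _)
      have := (posSemidef_ketbra (q (e.symm j)).2.ofLp).smul h
      rwa [Complex.coe_smul] at this
    · rw [Equiv.sum_comp e.symm fun i => (d * w i) • ketbra (q i).2.ofLp (q i).2.ofLp]
      have h1 := congrArg Prod.fst hsum
      simp only [Prod.fst_sum, Prod.smul_fst, ← hqz] at h1
      simp only [mul_smul]
      rw [← Finset.smul_sum, h1, hI₀, smul_smul, mul_inv_cancel₀ hd0.ne', one_smul]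
    · exact isState_ketbra _ (by simpa using (hq (e.symm j)).1)
    · have h1 := congrArg Prod.snd hsum
      simp only [Prod.snd_sum, Prod.smul_snd, ← hqz] at h1
      refine (congrArg Complex.re (Equiv.sum_comp e.symm fun i =>
        (Ω * (ketbra (q i).1.ofLp (q i).1.ofLp ⊗ₖ
          ((d * w i) • ketbra (q i).2.ofLp (q i).2.ofLp))).trace)).trans ?_
      rw [← h1, Complex.re_sum, Finset.mul_sum]
      refine Finset.sum_congr rfl fun i _ => ?_
      rw [Matrix.kronecker_smul, mul_smul_comm, trace_smul, Complex.smul_re, ← prodForm_eq_trace,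
        smul_eq_mul, smul_eq_mul, mul_assoc]
  -- For s > S this point lies strictly above K. A separating functional has the form Tr[Z X] + μ t
  -- on Hermitian X.
  · have hnot : (I₀, s / d) ∉ K := by
      intro hmem
      have h1 : s / d ≤ t₀ := hmax (a := (I₀, s / d)) ⟨hmem, rfl⟩
      rw [div_le_iff₀ hd0] at h1
      linarith
    have : LocallyConvexSpace ℝ (Matrix A A ℂ) :=
      inferInstanceAs (LocallyConvexSpace ℝ (A → A → ℂ))
    obtain ⟨f, c, hf, hc⟩ := geometric_hahn_banach_closed_point (convex_convexHull ℝ _)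
      hKc.isClosed hnot
    set μ := f (0, 1) with hμ
    let g : Matrix A A ℂ →ₗ[ℝ] ℝ := f.toLinearMap ∘ₗ LinearMap.inl ℝ (Matrix A A ℂ) ℝ
    have hfg : ∀ X t, f (X, t) = g X + t * μ := by
      intro X t
      have h : ((X, t) : Matrix A A ℂ × ℝ) = (X, 0) + t • (0, 1) := by simp
      rw [h, map_add, map_smul, smul_eq_mul]
      rfl
    obtain ⟨Z, hZ, hgZ⟩ := exists_isHermitian_forall_eq_re_trace g
    have h0 := hf _ hxK
    rw [hfg] at h0 hc
    -- The highest point of K above `I₀` and the excluded point differ only in height, so the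
    -- hyperplane is not vertical.
    have hμ0 : 0 < μ := by
      have h1 : t₀ * μ < s / d * μ := by linarith
      have h2 : t₀ < s / d := by
        rw [lt_div_iff₀ hd0]
        linarith
      by_contra hneg
      nlinarith
    have hI : g I₀ = d⁻¹ * (Z.trace).re := by
      rw [hI₀, map_smul, hgZ _ isHermitian_one, mul_one, smul_eq_mul]
    -- On unit vectors, separation reads ⟨v|Z|v⟩ + μ ⟨u|⟨v|Ω|u⟩|v⟩ < c; solving for the product
    -- expectation gives this Y. The strict inequality at the excluded point becomes Tr Y < s.
    refine ⟨μ⁻¹ • (c • 1 - Z), ?_, dominates_of_forall_unit fun u v hu hv => ?_, ?_⟩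
    · rw [Matrix.IsHermitian, conjTranspose_smul, conjTranspose_sub, conjTranspose_smul,
        conjTranspose_one, hZ.eq, star_trivial, star_trivial]
    · have h1 := hf _ (subset_convexHull ℝ _ ⟨(u, v), by simp [hu, hv], rfl⟩)
      rw [hfg, hgZ _ (posSemidef_ketbra _).isHermitian, trace_mul_ketbra] at h1
      simp only [smul_mulVec, sub_mulVec, one_mulVec, dotProduct_smul, dotProduct_sub,
        Complex.smul_re, Complex.sub_re, smul_eq_mul, re_star_dotProduct_self, hv] at h1 ⊢
      rw [inv_mul_eq_div, le_div_iff₀ hμ0]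
      linarith
    · rw [trace_smul, trace_sub, trace_smul, trace_one, Complex.smul_re, Complex.sub_re,
        Complex.smul_re, smul_eq_mul, smul_eq_mul, Complex.natCast_re, ← hd, inv_mul_eq_div,
        div_lt_iff₀ hμ0]
      rw [hI] at hc
      have h3 : c * d < (d⁻¹ * (Z.trace).re + s / d * μ) * d := by gcongr
      have h4 : (d⁻¹ * (Z.trace).re + s / d * μ) * d = (Z.trace).re + s * μ := by
        field_simp
      linarith

end Duality

/-! ### Square roots and support projections -/

section FunctionalCalculus

variable {A : Type*} [Fintype A] [DecidableEq A]

/-- An eigenvector of a Hermitian matrix is an eigenvector of its functional calculus. -/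
theorem cfc_mulVec_of_mulVec_eq {M : Matrix A A ℂ} (hM : M.IsHermitian) (f : ℝ → ℝ) {v : A → ℂ}
    {μ : ℝ} (hv : M *ᵥ v = (μ : ℂ) • v) : cfc f M *ᵥ v = (f μ : ℂ) • v := by
  set U : Matrix A A ℂ := (hM.eigenvectorUnitary : Matrix A A ℂ) with hU
  have hUU : star U * U = 1 := Unitary.coe_star_mul_self hM.eigenvectorUnitary
  have hUU' : U * star U = 1 := Unitary.coe_mul_star_self hM.eigenvectorUnitary
  have hspec : M = U * diagonal (RCLike.ofReal ∘ hM.eigenvalues) * star U := by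
    conv_lhs => rw [hM.spectral_theorem, Unitary.conjStarAlgAut_apply]
  have hf : cfc f M = U * diagonal (RCLike.ofReal ∘ f ∘ hM.eigenvalues) * star U := by
    rw [hM.cfc_eq, Matrix.IsHermitian.cfc, Unitary.conjStarAlgAut_apply]
  set w := star U *ᵥ v with hw
  have hvw : v = U *ᵥ w := by rw [hw, mulVec_mulVec, hUU', one_mulVec]
  have hdiag : diagonal (RCLike.ofReal ∘ hM.eigenvalues) *ᵥ w = (μ : ℂ) • w := by
    have h := congrArg (star U *ᵥ ·) hv
    rw [hspec] at h
    simp only [mulVec_mulVec, mulVec_smul] at h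
    rwa [← mul_assoc, ← mul_assoc, hUU, one_mul, ← mulVec_mulVec, ← hw] at h
  have hdiag' : diagonal (RCLike.ofReal ∘ f ∘ hM.eigenvalues) *ᵥ w = (f μ : ℂ) • w := by
    ext i
    have h := congrFun hdiag i
    simp only [mulVec_diagonal, Function.comp_apply, Pi.smul_apply, smul_eq_mul,
      Complex.coe_algebraMap] at h ⊢
    by_cases hi : w i = 0
    · simp [hi]
    · have h1 : hM.eigenvalues i = μ := by exact_mod_cast mul_right_cancel₀ hi h
      rw [h1]
  rw [hf, ← mulVec_mulVec, ← mulVec_mulVec, ← hw, hdiag', mulVec_smul, ← hvw]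

/-- Reduces the identities between functions of τ below to scalar identities at each eigenvalue, the
eigenvalue 0 included. -/
theorem ext_eigenvectorBasis {M X Y : Matrix A A ℂ} (hM : M.IsHermitian)
    (h : ∀ i, X *ᵥ (hM.eigenvectorBasis i).ofLp = Y *ᵥ (hM.eigenvectorBasis i).ofLp) : X = Y := by
  have h1 : Matrix.toEuclideanLin X = Matrix.toEuclideanLin Y := by
    refine hM.eigenvectorBasis.toBasis.ext fun i => ?_
    rw [OrthonormalBasis.coe_toBasis, Matrix.toLpLin_apply, Matrix.toLpLin_apply, h]
  exact Matrix.toEuclideanLin.injective h1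

theorem isHermitian_cfc (f : ℝ → ℝ) (M : Matrix A A ℂ) : (cfc f M).IsHermitian :=
  cfc_predicate f M

/-- The projection onto the support. -/
def supportProj (M : Matrix A A ℂ) : Matrix A A ℂ := cfc (fun x : ℝ => if x = 0 then 0 else 1) M

theorem isHermitian_invSqrt (M : Matrix A A ℂ) : (invSqrt M).IsHermitian := isHermitian_cfc _ M

/-- The positive square root. -/
def sqrtMat (M : Matrix A A ℂ) : Matrix A A ℂ := cfc Real.sqrt M

theorem mulVec_eigenvectorBasis_complex {M : Matrix A A ℂ} (hM : M.IsHermitian) (i : A) :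
    M *ᵥ (hM.eigenvectorBasis i).ofLp = (hM.eigenvalues i : ℂ) • (hM.eigenvectorBasis i).ofLp := by
  rw [hM.mulVec_eigenvectorBasis, Complex.coe_smul]

theorem sqrtMat_mul_sqrtMat {τ : Matrix A A ℂ} (hτ : τ.PosSemidef) :
    sqrtMat τ * sqrtMat τ = τ := by
  refine ext_eigenvectorBasis hτ.isHermitian fun i => ?_
  have h := mulVec_eigenvectorBasis_complex hτ.isHermitian i
  rw [← mulVec_mulVec, sqrtMat, cfc_mulVec_of_mulVec_eq hτ.isHermitian _ h, mulVec_smul,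
    cfc_mulVec_of_mulVec_eq hτ.isHermitian _ h, smul_smul, h, ← Complex.ofReal_mul,
    Real.mul_self_sqrt (hτ.eigenvalues_nonneg i)]

theorem invSqrt_mul_sqrtMat {τ : Matrix A A ℂ} (hτ : τ.PosSemidef) :
    invSqrt τ * sqrtMat τ = supportProj τ := by
  refine ext_eigenvectorBasis hτ.isHermitian fun i => ?_
  have h := mulVec_eigenvectorBasis_complex hτ.isHermitian i
  rw [← mulVec_mulVec, sqrtMat, cfc_mulVec_of_mulVec_eq hτ.isHermitian _ h, mulVec_smul, invSqrt,
    cfc_mulVec_of_mulVec_eq hτ.isHermitian _ h, smul_smul, supportProj,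
    cfc_mulVec_of_mulVec_eq hτ.isHermitian _ h, ← Complex.ofReal_mul]
  congr 2
  split_ifs with h0
  · simp [h0]
  · exact mul_inv_cancel₀ (Real.sqrt_ne_zero'.mpr
      (lt_of_le_of_ne (hτ.eigenvalues_nonneg i) (Ne.symm h0)))

theorem mul_supportProj {τ : Matrix A A ℂ} (hτ : τ.PosSemidef) : τ * supportProj τ = τ := by
  refine ext_eigenvectorBasis hτ.isHermitian fun i => ?_
  have h := mulVec_eigenvectorBasis_complex hτ.isHermitian i
  rw [← mulVec_mulVec, supportProj, cfc_mulVec_of_mulVec_eq hτ.isHermitian _ h, mulVec_smul, h,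
    smul_smul]
  split_ifs with h0 <;> simp [h0]

theorem supportProj_mul_self {τ : Matrix A A ℂ} (hτ : τ.PosSemidef) :
    supportProj τ * supportProj τ = supportProj τ := by
  refine ext_eigenvectorBasis hτ.isHermitian fun i => ?_
  have h := mulVec_eigenvectorBasis_complex hτ.isHermitian i
  rw [← mulVec_mulVec, supportProj, cfc_mulVec_of_mulVec_eq hτ.isHermitian _ h, mulVec_smul,
    cfc_mulVec_of_mulVec_eq hτ.isHermitian _ h, smul_smul]
  split_ifs with h0 <;> simp

theorem invSqrt_mul_mul_invSqrt {τ : Matrix A A ℂ} (hτ : τ.PosSemidef) :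
    invSqrt τ * τ * invSqrt τ = supportProj τ := by
  have h : sqrtMat τ * invSqrt τ = supportProj τ := by
    have h1 := congrArg conjTranspose (invSqrt_mul_sqrtMat hτ)
    rwa [conjTranspose_mul, invSqrt, sqrtMat, supportProj, (isHermitian_cfc _ _).eq,
      (isHermitian_cfc _ _).eq, (isHermitian_cfc _ _).eq] at h1
  have h2 : supportProj τ * supportProj τ = supportProj τ := supportProj_mul_self hτ
  calc invSqrt τ * τ * invSqrt τ
      = (invSqrt τ * sqrtMat τ) * (sqrtMat τ * invSqrt τ) := by
        rw [mul_assoc (invSqrt τ) (sqrtMat τ), ← mul_assoc (sqrtMat τ), sqrtMat_mul_sqrtMat hτ,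
          mul_assoc]
    _ = supportProj τ := by rw [invSqrt_mul_sqrtMat hτ, h, h2]

theorem re_dotProduct_supportProj_le {τ : Matrix A A ℂ} (hτ : τ.PosSemidef) (v : A → ℂ) :
    (star v ⬝ᵥ supportProj τ *ᵥ v).re ≤ (star v ⬝ᵥ v).re := by
  have h1 : (1 - supportProj τ)ᴴ * (1 - supportProj τ) = 1 - supportProj τ := by
    rw [conjTranspose_sub, conjTranspose_one, supportProj, (isHermitian_cfc _ _).eq,
      ← supportProj, sub_mul, mul_sub, mul_sub, supportProj_mul_self hτ]
    simp
  have h2 := (posSemidef_conjTranspose_mul_self (1 - supportProj τ)).dotProduct_mulVec_nonneg v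
  rw [h1, sub_mulVec, one_mulVec, dotProduct_sub] at h2
  have h3 := (Complex.le_def.mp h2).1
  simpa using h3

end FunctionalCalculus

/-! ### PPT operators, and domination versus the benchmark function -/

section ProductForm

variable {A A' : Type*} [Fintype A] [Fintype A'] [DecidableEq A] [DecidableEq A']

theorem kronecker_mulVec_prodVec (M : Matrix A' A' ℂ) (N : Matrix A A ℂ) (u : A' → ℂ)
    (v : A → ℂ) : (M ⊗ₖ N) *ᵥ prodVec u v = prodVec (M *ᵥ u) (N *ᵥ v) := by
  ext x
  simp only [mulVec, dotProduct, prodVec, kroneckerMap_apply, Fintype.sum_prod_type,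
    Finset.sum_mul_sum]
  exact Finset.sum_congr rfl fun i _ => Finset.sum_congr rfl fun j _ => by ring

theorem prodForm_conj_kronecker (Ω : Matrix (A' × A) (A' × A) ℂ) {N : Matrix A A ℂ}
    (hN : N.IsHermitian) (u : A' → ℂ) (v : A → ℂ) :
    prodForm (((1 : Matrix A' A' ℂ) ⊗ₖ N) * Ω * ((1 : Matrix A' A' ℂ) ⊗ₖ N)) u v =
      prodForm Ω u (N *ᵥ v) := by
  have h1 : ((1 : Matrix A' A' ℂ) ⊗ₖ N)ᴴ = (1 : Matrix A' A' ℂ) ⊗ₖ N := by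
    rw [conjTranspose_kronecker, conjTranspose_one, hN.eq]
  have h2 : ((1 : Matrix A' A' ℂ) ⊗ₖ N) *ᵥ prodVec u v = prodVec u (N *ᵥ v) := by
    rw [kronecker_mulVec_prodVec, one_mulVec]
  rw [prodForm, prodForm, ← mulVec_mulVec, ← mulVec_mulVec, h2, dotProduct_mulVec, ← h2]
  conv_rhs => rw [star_mulVec, h1]

/-- Transposition sends |v⟩⟨v| to the projector on the conjugate vector. This is how PPT makes
product expectations nonnegative without Ω being positive. -/
theorem prodForm_partialTranspose (Ω : Matrix (A' × A) (A' × A) ℂ) (u : A' → ℂ) (v : A → ℂ) :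
    prodForm (partialTranspose Ω) u (star v) = prodForm Ω u v := by
  simp only [prodForm, dotProduct, mulVec, prodVec, partialTranspose, Matrix.of_apply,
    Pi.star_apply, star_mul', star_star, Fintype.sum_prod_type, Finset.mul_sum]
  congr 1
  refine Finset.sum_congr rfl fun a' _ => ?_
  rw [Finset.sum_comm]
  conv_rhs => rw [Finset.sum_comm]
  refine Finset.sum_congr rfl fun b' _ => ?_
  rw [Finset.sum_comm]
  exact Finset.sum_congr rfl fun b _ => Finset.sum_congr rfl fun a _ => by ring

theorem IsPPT.prodForm_nonneg {Ω : Matrix (A' × A) (A' × A) ℂ} (hΩ : IsPPT Ω) (u : A' → ℂ)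
    (v : A → ℂ) : 0 ≤ prodForm Ω u v := by
  rw [← prodForm_partialTranspose]
  exact (Complex.le_def.mp (PosSemidef.dotProduct_mulVec_nonneg hΩ _)).1

/-- For an operator with positive partial transpose, product vectors with vanishing expectation
span a subspace of the kernel. -/
theorem IsPPT.mulVec_prodVec_eq_zero {Ω : Matrix (A' × A) (A' × A) ℂ} (hΩ : IsPPT Ω)
    (hH : Ω.IsHermitian) {v : A → ℂ} (hv : ∀ u, prodForm Ω u v = 0) (u : A' → ℂ) :
    Ω *ᵥ prodVec u v = 0 := by
  have h1 : ∀ a' b' b, ∑ a, Ω (a', a) (b', b) * star (v a) = 0 := by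
    intro a' b' b
    have h2 := hv (Pi.single b' 1)
    rw [← prodForm_partialTranspose] at h2
    -- A positive form vanishing at a vector annihilates it. Read entrywise, this is the conjugate
    -- of the wanted kernel relation, which Hermiticity of Ω then recovers.
    have h3 := (PosSemidef.dotProduct_mulVec_zero_iff hΩ (prodVec (Pi.single b' 1) (star v))).mp
      (Complex.ext h2 (hΩ.isHermitian.im_star_dotProduct_mulVec_self _))
    have h4 := congrFun h3 (a', b)
    simp only [mulVec, dotProduct, Fintype.sum_prod_type, partialTranspose, Matrix.of_apply,
      prodVec, Pi.star_apply, Pi.zero_apply] at h4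
    rw [Finset.sum_eq_single b' (fun c _ hc => by simp [hc]) (by simp)] at h4
    simpa using h4
  ext ⟨b', b⟩
  simp only [mulVec, dotProduct, Fintype.sum_prod_type, prodVec, Pi.zero_apply]
  refine Finset.sum_eq_zero fun a' _ => ?_
  have h2 := congrArg star (h1 a' b' b)
  simp only [star_sum, star_mul', star_star, star_zero, hH.apply] at h2
  calc _ = u a' * ∑ a, Ω (b', b) (a', a) * v a := by
        rw [Finset.mul_sum]
        exact Finset.sum_congr rfl fun _ _ => by ring
    _ = 0 := by rw [h2, mul_zero]

/-- The kernel of I ⊗ τ is spanned by product vectors whose second factor lies in the kernel of τ.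
-/
theorem mem_admissibleStates_iff {Ω : Matrix (A' × A) (A' × A) ℂ} {τ : Matrix A A ℂ} :
    τ ∈ admissibleStates Ω ↔
      IsState τ ∧ ∀ v, τ *ᵥ v = 0 → ∀ u, Ω *ᵥ prodVec u v = 0 := by
  refine and_congr_right fun _ => ⟨fun h v hv u => h _ ?_, fun h w hw => ?_⟩
  · rw [kronecker_mulVec_prodVec, hv]
    ext
    simp [prodVec]
  · have h1 : w = ∑ a', prodVec (Pi.single a' 1) fun a => w (a', a) := by
      ext ⟨b', b⟩
      simp [prodVec, Pi.single_apply]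
    have h2 : ∀ a', τ *ᵥ (fun a => w (a', a)) = 0 := by
      intro a'
      ext a
      have h3 := congrFun hw (a', a)
      simp only [mulVec, dotProduct, Fintype.sum_prod_type, kroneckerMap_apply, Matrix.one_apply,
        Pi.zero_apply] at h3
      rw [Finset.sum_eq_single a' (fun c _ hc => by simp [Ne.symm hc]) (by simp)] at h3
      simpa [mulVec, dotProduct] using h3
    rw [h1, mulVec_sum]
    exact Finset.sum_eq_zero fun a' _ => h _ (h2 a') _

/-- Compactness of the unit spheres; without boundedness the real `sSup` would take its default
value 0. -/
theorem bddAbove_prodForm (M : Matrix (A' × A) (A' × A) ℂ) :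
    BddAbove {t : ℝ | ∃ (α' : EuclideanSpace ℂ A') (α : EuclideanSpace ℂ A), ‖α'‖ = 1 ∧ ‖α‖ = 1 ∧
      t = prodForm M α' α} := by
  refine ((isCompact_pureProductPoints M).image continuous_snd).bddAbove.mono ?_
  rintro t ⟨u, v, hu, hv, rfl⟩
  exact ⟨_, ⟨(u, v), by simp [hu, hv], rfl⟩, rfl⟩

theorem dominates_productNumericalSup (M : Matrix (A' × A) (A' × A) ℂ) :
    Dominates (productNumericalSup M • (1 : Matrix A A ℂ)) M := by
  refine dominates_of_forall_unit fun u v hu hv => ?_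
  rw [smul_mulVec, one_mulVec, dotProduct_smul, Complex.smul_re, re_star_dotProduct_self, hv]
  have h : prodForm M u v ≤ productNumericalSup M :=
    le_csSup (bddAbove_prodForm M) ⟨u, v, hu, hv, rfl⟩
  simpa using h

theorem productNumericalSup_le [Nonempty A] [Nonempty A'] {M : Matrix (A' × A) (A' × A) ℂ} {c : ℝ}
    (h : ∀ (u : EuclideanSpace ℂ A') (v : EuclideanSpace ℂ A), ‖u‖ = 1 → ‖v‖ = 1 →
      prodForm M u v ≤ c) : productNumericalSup M ≤ c := by
  obtain ⟨a⟩ := ‹Nonempty A›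
  obtain ⟨a'⟩ := ‹Nonempty A'›
  refine csSup_le ⟨_, EuclideanSpace.single a' 1, EuclideanSpace.single a 1, by simp, by simp, rfl⟩ ?_
  rintro t ⟨u, v, hu, hv, rfl⟩
  exact h u v hu hv

/-- Admissibility lets v be replaced by its component on the support of τ, which is τ^{-1/2} applied
to τ^{1/2} v. The supremum, tested at τ^{1/2} v, brings in the squared norm ⟨v|τ|v⟩. -/
theorem dominates_benchmarkFun {Ω : Matrix (A' × A) (A' × A) ℂ} (hH : Ω.IsHermitian)
    {τ : Matrix A A ℂ} (hτ : τ ∈ admissibleStates Ω) : Dominates (benchmarkFun Ω τ • τ) Ω := by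
  obtain ⟨hs, hker⟩ := mem_admissibleStates_iff.mp hτ
  intro u v
  set w := supportProj τ *ᵥ v with hw
  have h0 : Ω *ᵥ prodVec u (v - w) = 0 := by
    refine hker _ ?_ u
    rw [mulVec_sub, hw, mulVec_mulVec, mul_supportProj hs.1, sub_self]
  have hsplit : prodVec u v = prodVec u w + prodVec u (v - w) := by
    ext i
    simp only [prodVec, Pi.add_apply, Pi.sub_apply]
    ring
  have h1 : prodForm Ω u v = prodForm Ω u w := by
    have h2 : star (prodVec u (v - w)) ⬝ᵥ Ω *ᵥ prodVec u w = 0 := by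
      rw [dotProduct_mulVec, ← hH.eq, ← star_mulVec, h0, star_zero, zero_dotProduct]
    rw [prodForm, hsplit, mulVec_add, h0, add_zero, star_add, add_dotProduct, h2, add_zero,
      prodForm]
  have h2 : w = invSqrt τ *ᵥ (sqrtMat τ *ᵥ v) := by
    rw [hw, mulVec_mulVec, invSqrt_mul_sqrtMat hs.1]
  have h3 := dominates_productNumericalSup
    (((1 : Matrix A' A' ℂ) ⊗ₖ invSqrt τ) * Ω * ((1 : Matrix A' A' ℂ) ⊗ₖ invSqrt τ)) u
    (sqrtMat τ *ᵥ v)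
  rw [prodForm_conj_kronecker Ω (isHermitian_invSqrt τ), ← h2, ← h1] at h3
  refine h3.trans_eq ?_
  rw [smul_mulVec, one_mulVec, dotProduct_smul, smul_mulVec, dotProduct_smul, star_mulVec,
    ← dotProduct_mulVec, mulVec_mulVec, sqrtMat, (isHermitian_cfc _ _).eq, ← sqrtMat,
    sqrtMat_mul_sqrtMat hs.1]
  rfl

/-- For v in the kernel of τ, domination bounds the product expectations above by 0 and PPT bounds
them below by 0; PPT then upgrades vanishing to membership in the kernel of Ω. -/
theorem mem_admissibleStates_of_dominates {Ω : Matrix (A' × A) (A' × A) ℂ} (hH : Ω.IsHermitian)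
    (hΩ : IsPPT Ω) {τ : Matrix A A ℂ} (hτ : IsState τ) {S : ℝ} (h : Dominates (S • τ) Ω) :
    τ ∈ admissibleStates Ω := by
  refine mem_admissibleStates_iff.mpr ⟨hτ, fun v hv u => ?_⟩
  refine hΩ.mulVec_prodVec_eq_zero hH (fun u => ?_) u
  refine le_antisymm ((h u v).trans_eq ?_) (hΩ.prodForm_nonneg u v)
  simp [smul_mulVec, hv]

/-- Substituting τ^{-1/2} v turns S τ into S times the support projection; as this is at most 1, the
sign of S matters. -/
theorem benchmarkFun_le_of_dominates [Nonempty A] [Nonempty A'] {Ω : Matrix (A' × A) (A' × A) ℂ}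
    {τ : Matrix A A ℂ} (hτ : τ.PosSemidef) {S : ℝ} (hS : 0 ≤ S) (h : Dominates (S • τ) Ω) :
    benchmarkFun Ω τ ≤ S := by
  refine productNumericalSup_le fun u v hu hv => ?_
  rw [prodForm_conj_kronecker Ω (isHermitian_invSqrt τ)]
  refine (h _ _).trans ?_
  rw [re_star_dotProduct_self, hu, smul_mulVec, dotProduct_smul, star_mulVec, invSqrt,
    (isHermitian_cfc _ _).eq, ← invSqrt, ← dotProduct_mulVec, mulVec_mulVec, mulVec_mulVec,
    invSqrt_mul_mul_invSqrt hτ, Complex.smul_re]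
  have h1 := re_dotProduct_supportProj_le hτ v
  rw [re_star_dotProduct_self, hv] at h1
  rw [smul_eq_mul]
  nlinarith

/-- For an operator with positive partial transpose the dual optimum is attained. -/
theorem exists_posSemidef_dominates_trace_le {Ω : Matrix (A' × A) (A' × A) ℂ} (hΩ : IsPPT Ω)
    [Nonempty A'] {S : ℝ}
    (h : ∀ s, S < s → ∃ Y : Matrix A A ℂ, Y.IsHermitian ∧ Dominates Y Ω ∧ (Y.trace).re < s) :
    ∃ Y : Matrix A A ℂ, Y.PosSemidef ∧ Dominates Y Ω ∧ (Y.trace).re ≤ S := by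
  -- With Y = B†B the trace becomes the squared Euclidean norm of B, so an optimum is a point of a
  -- closed set nearest to the origin.
  let mat : EuclideanSpace ℂ (A × A) → Matrix A A ℂ := fun B => Matrix.of fun i j => B (i, j)
  have htr : ∀ B, (((mat B)ᴴ * mat B).trace).re = ‖B‖ ^ 2 := by
    intro B
    rw [EuclideanSpace.norm_sq_eq, Fintype.sum_prod_type, Finset.sum_comm, Matrix.trace,
      Complex.re_sum]
    refine Finset.sum_congr rfl fun i _ => ?_
    rw [Matrix.diag, Matrix.mul_apply, Complex.re_sum]
    refine Finset.sum_congr rfl fun j _ => ?_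
    rw [conjTranspose_apply, Complex.star_def, ← Complex.normSq_eq_conj_mul_self,
      Complex.ofReal_re, Complex.normSq_eq_norm_sq]
    rfl
  have hpsd : ∀ s, S < s → ∃ B, Dominates ((mat B)ᴴ * mat B) Ω ∧ ‖B‖ ^ 2 < s := by
    intro s hs
    obtain ⟨Y, hYH, hY, hYs⟩ := h s hs
    have hY0 : Y.PosSemidef := by
      refine posSemidef_of_re_nonneg hYH fun v => ?_
      obtain ⟨a'⟩ := ‹Nonempty A'›
      have h1 := (hΩ.prodForm_nonneg (Pi.single a' 1) v).trans (hY _ _)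
      simpa using h1
    obtain ⟨B, rfl⟩ := exists_conjTranspose_mul_self hY0
    refine ⟨WithLp.toLp 2 fun p => B p.1 p.2, hY, ?_⟩
    rw [← htr]
    exact hYs
  have hclosed : IsClosed {B | Dominates ((mat B)ᴴ * mat B) Ω} := by
    simp only [Dominates, Set.ofPred_forall]
    refine isClosed_iInter fun u => isClosed_iInter fun v => isClosed_le continuous_const ?_
    simp only [dotProduct, mulVec, Matrix.mul_apply, conjTranspose_apply, mat, Matrix.of_apply]
    fun_prop
  obtain ⟨B₀, hB₀, -⟩ := hpsd (S + 1) (by linarith)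
  obtain ⟨B, hB, hmin⟩ := hclosed.exists_infDist_eq_dist ⟨B₀, hB₀⟩ 0
  refine ⟨_, posSemidef_conjTranspose_mul_self (mat B), hB, ?_⟩
  rw [htr]
  refine le_of_forall_gt_imp_ge_of_dense fun s hs => ?_
  obtain ⟨B₁, hB₁, hlt⟩ := hpsd s hs
  have h1 : ‖B‖ ≤ ‖B₁‖ := by
    have h2 := Metric.infDist_le_dist_of_mem (s := {B | Dominates ((mat B)ᴴ * mat B) Ω})
      (x := 0) hB₁
    rw [hmin, dist_zero_left, dist_zero_left] at h2
    exact h2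
  have h3 : ‖B‖ ^ 2 ≤ ‖B₁‖ ^ 2 := by gcongr
  linarith

end ProductForm

/-! ### Rank-one operators in orthonormal bases -/

section OrthonormalBases

variable {A R : Type*} [Fintype A] [Fintype R] [DecidableEq A] [DecidableEq R]

theorem mul_ketbra {X Y Z : Type*} [Fintype Y] (M : Matrix X Y ℂ) (v : Y → ℂ) (w : Z → ℂ) :
    M * ketbra v w = ketbra (M *ᵥ v) w := by
  rw [ketbra, ketbra, mul_vecMulVec]

theorem conjTranspose_ketbra {X Y : Type*} (v : X → ℂ) (w : Y → ℂ) :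
    (ketbra v w)ᴴ = ketbra w v := by
  ext i j
  simp [ketbra, vecMulVec_apply, mul_comm]

theorem ketbra_mulVec {X Y : Type*} [Fintype Y] (v : X → ℂ) (w x : Y → ℂ) :
    ketbra v w *ᵥ x = (star w ⬝ᵥ x) • v := by
  ext i
  simp only [ketbra, mulVec, vecMulVec_apply, dotProduct, Pi.smul_apply, smul_eq_mul,
    Finset.sum_mul]
  exact Finset.sum_congr rfl fun _ _ => by ring

theorem mul_ketbra_mul_conjTranspose {X Y Z W : Type*} [Fintype Y] [Fintype Z] (M : Matrix X Y ℂ)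
    (N : Matrix W Z ℂ) (v : Y → ℂ) (w : Z → ℂ) :
    M * ketbra v w * Nᴴ = ketbra (M *ᵥ v) (N *ᵥ w) := by
  rw [mul_ketbra, ketbra, ketbra, vecMulVec_mul, star_mulVec]

theorem inner_eq_star_dotProduct' {n : Type*} [Fintype n] (x y : EuclideanSpace ℂ n) :
    inner ℂ x y = star x.ofLp ⬝ᵥ y.ofLp := by
  rw [EuclideanSpace.inner_eq_star_dotProduct, dotProduct_comm]

theorem star_dotProduct_basis (φ : OrthonormalBasis A ℂ (EuclideanSpace ℂ A)) (m n : A) :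
    star (φ m).ofLp ⬝ᵥ (φ n).ofLp = if m = n then 1 else 0 := by
  rw [← inner_eq_star_dotProduct', orthonormal_iff_ite.mp φ.orthonormal m n]

theorem sum_ketbra_basis (φ : OrthonormalBasis A ℂ (EuclideanSpace ℂ A)) :
    ∑ n, ketbra (φ n).ofLp (φ n).ofLp = 1 := by
  ext a b
  have h := φ.sum_inner_mul_inner (EuclideanSpace.single a 1) (EuclideanSpace.single b 1)
  simpa [inner_eq_star_dotProduct', Matrix.sum_apply, ketbra, vecMulVec_apply, Matrix.one_apply,
    Pi.single_apply, eq_comm (a := b)] using h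

theorem eq_sum_mulVec_ketbra (φ : OrthonormalBasis A ℂ (EuclideanSpace ℂ A)) {X : Type*}
    (M : Matrix X A ℂ) : M = ∑ n, ketbra (M *ᵥ (φ n).ofLp) (φ n).ofLp := by
  simp only [← mul_ketbra]
  rw [← Matrix.mul_sum, sum_ketbra_basis, Matrix.mul_one]

end OrthonormalBases

/-! ### Purifications and Schmidt decompositions -/

section Purification

variable {A R : Type*} [Fintype A] [Fintype R] [DecidableEq A] [DecidableEq R]

/-- The coefficient matrix of a bipartite vector. -/
def coeffMat (Φ : A × R → ℂ) : Matrix A R ℂ := Matrix.of fun a r => Φ (a, r)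

theorem ptraceRight_ketbra (Φ : A × R → ℂ) :
    ptraceRight (ketbra Φ Φ) = coeffMat Φ * (coeffMat Φ)ᴴ := by
  ext a b
  simp [ptraceRight, ketbra, vecMulVec_apply, coeffMat, Matrix.mul_apply]

theorem ptraceLeft_ketbra (Φ : A × R → ℂ) :
    ptraceLeft (ketbra Φ Φ) = ((coeffMat Φ)ᴴ * coeffMat Φ)ᵀ := by
  ext r s
  simp [ptraceLeft, ketbra, vecMulVec_apply, coeffMat, Matrix.mul_apply, mul_comm]

theorem isHermitian_ptraceLeft_ketbra (Φ : A × R → ℂ) :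
    (ptraceLeft (ketbra Φ Φ)).IsHermitian := by
  rw [ptraceLeft_ketbra]
  exact (posSemidef_conjTranspose_mul_self _).transpose.isHermitian

theorem exists_isPurification {τ : Matrix A A ℂ} (hτ : τ.PosSemidef) :
    ∃ Φ : A × A → ℂ, IsPurification Φ τ := by
  obtain ⟨B, hB⟩ := exists_conjTranspose_mul_self hτ
  refine ⟨fun p => Bᴴ p.1 p.2, ?_⟩
  have h : coeffMat (fun p : A × A => Bᴴ p.1 p.2) = Bᴴ := rfl
  rw [IsPurification, ptraceRight_ketbra, h, conjTranspose_conjTranspose, hB]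

/-- For an eigenbasis φ of M M†, M the coefficient matrix, the rows φₙ† M are orthogonal with
squared norms the eigenvalues. Dividing by the square roots gives the ψₙ; for eigenvalue 0 the row
vanishes and ψₙ = 0. -/
theorem nonempty_schmidtDecomposition (Φ : A × R → ℂ) : Nonempty (SchmidtDecomposition Φ) := by
  set M := coeffMat Φ with hM
  have hpsd : (M * Mᴴ).PosSemidef := posSemidef_self_mul_conjTranspose M
  set φ := hpsd.isHermitian.eigenvectorBasis with hφ
  set l := hpsd.isHermitian.eigenvalues with hl
  have hl0 : ∀ n, 0 ≤ l n := hpsd.eigenvalues_nonneg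
  let g : A → R → ℂ := fun n => star (φ n).ofLp ᵥ* M
  have hg : ∀ m n, star (g m) ⬝ᵥ g n = if m = n then (l m : ℂ) else 0 := by
    intro m n
    rw [star_vecMul, star_star, dotProduct_comm, ← dotProduct_mulVec, mulVec_mulVec, hφ,
      mulVec_eigenvectorBasis_complex, dotProduct_smul, ← hφ, star_dotProduct_basis, smul_eq_mul]
    by_cases h : m = n
    · simp [h, hl]
    · simp [h, Ne.symm h]
  have hg0 : ∀ n, l n = 0 → g n = 0 := by
    intro n hn
    have h := hg n n
    rw [if_pos rfl, hn, Complex.ofReal_zero] at h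
    exact dotProduct_star_self_eq_zero.mp h
  refine ⟨⟨l, φ, fun n => WithLp.toLp 2 (((Real.sqrt (l n) : ℂ)⁻¹) • g n), hl0, ?_, ?_⟩⟩
  · rw [orthonormal_iff_ite]
    rintro ⟨m, hm⟩ ⟨n, hn⟩
    rw [inner_eq_star_dotProduct']
    simp only [star_smul, smul_dotProduct, dotProduct_smul, hg, Subtype.mk.injEq]
    split_ifs with h
    · subst h
      have h1 : (Real.sqrt (l m) : ℂ) ≠ 0 := by
        exact_mod_cast Real.sqrt_ne_zero'.mpr (lt_of_le_of_ne (hl0 m) (Ne.symm hm))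
      have h2 : (l m : ℂ) = (Real.sqrt (l m) : ℂ) * (Real.sqrt (l m) : ℂ) := by
        exact_mod_cast (Real.mul_self_sqrt (hl0 m)).symm
      simp only [smul_eq_mul, star_inv₀, Complex.star_def, Complex.conj_ofReal]
      rw [h2]
      field_simp
    · simp
  · intro a r
    have h1 : M = ∑ n, vecMulVec (φ n).ofLp (g n) := by
      have h2 := congrArg (· * M) (sum_ketbra_basis φ)
      simp only [Matrix.sum_mul, Matrix.one_mul, ketbra, vecMulVec_mul] at h2
      exact h2.symm
    have h3 := congrFun (congrFun h1 a) r
    rw [Matrix.sum_apply] at h3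
    refine h3.trans (Finset.sum_congr rfl fun n _ => ?_)
    simp only [vecMulVec_apply, Pi.smul_apply, smul_eq_mul]
    by_cases hn : l n = 0
    · simp [hg0 n hn]
    · have h4 : (Real.sqrt (l n) : ℂ) ≠ 0 := by
        exact_mod_cast Real.sqrt_ne_zero'.mpr (lt_of_le_of_ne (hl0 n) (Ne.symm hn))
      field_simp

namespace SchmidtDecomposition

variable {Φ : A × R → ℂ} (D : SchmidtDecomposition Φ)

theorem coeffMat_eq :
    coeffMat Φ = ∑ n, (Real.sqrt (D.lam n) : ℂ) • vecMulVec (D.φ n).ofLp (D.ψ n).ofLp := by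
  ext a r
  simp [coeffMat, D.eq_sum, Matrix.sum_apply, vecMulVec_apply]

theorem star_dotProduct_ψ {m n : A} (hm : D.lam m ≠ 0) (hn : D.lam n ≠ 0) :
    star (D.ψ m).ofLp ⬝ᵥ (D.ψ n).ofLp = if m = n then 1 else 0 := by
  have h := orthonormal_iff_ite.mp D.orthonormal ⟨m, hm⟩ ⟨n, hn⟩
  rw [inner_eq_star_dotProduct'] at h
  simpa using h

theorem vecMul_coeffMat (n : A) :
    star (D.φ n).ofLp ᵥ* coeffMat Φ = (Real.sqrt (D.lam n) : ℂ) • (D.ψ n).ofLp := by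
  rw [D.coeffMat_eq, vecMul_sum, Finset.sum_eq_single n]
  · rw [vecMul_smul, vecMul_vecMulVec, star_dotProduct_basis, if_pos rfl, one_smul]
  · intro m _ hm
    rw [vecMul_smul, vecMul_vecMulVec, star_dotProduct_basis, if_neg hm.symm, zero_smul, smul_zero]
  · simp

theorem coeffMat_mulVec {n : A} (hn : D.lam n ≠ 0) :
    coeffMat Φ *ᵥ star (D.ψ n).ofLp = (Real.sqrt (D.lam n) : ℂ) • (D.φ n).ofLp := by
  rw [D.coeffMat_eq, sum_mulVec, Finset.sum_eq_single n]
  · rw [smul_mulVec, vecMulVec_mulVec, dotProduct_comm, D.star_dotProduct_ψ hn hn, if_pos rfl]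
    simp
  · intro m _ hm
    by_cases h : D.lam m = 0
    · simp [h]
    · rw [smul_mulVec, vecMulVec_mulVec, dotProduct_comm, D.star_dotProduct_ψ hn h,
        if_neg hm.symm]
      simp
  · simp

theorem sqrt_mul_sqrt (n : A) :
    (Real.sqrt (D.lam n) : ℂ) * (Real.sqrt (D.lam n) : ℂ) = D.lam n := by
  exact_mod_cast Real.mul_self_sqrt (D.lam_nonneg n)

theorem ptraceRight_mulVec (n : A) :
    ptraceRight (ketbra Φ Φ) *ᵥ (D.φ n).ofLp = (D.lam n : ℂ) • (D.φ n).ofLp := by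
  have h : (coeffMat Φ)ᴴ *ᵥ (D.φ n).ofLp = (Real.sqrt (D.lam n) : ℂ) • star (D.ψ n).ofLp := by
    have h1 := congrArg star (D.vecMul_coeffMat n)
    rw [star_vecMul, star_star, star_smul, Complex.star_def, Complex.conj_ofReal] at h1
    exact h1
  rw [ptraceRight_ketbra, ← mulVec_mulVec, h, mulVec_smul]
  by_cases hn : D.lam n = 0
  · simp [hn]
  · rw [D.coeffMat_mulVec hn, smul_smul, D.sqrt_mul_sqrt]

theorem ptraceLeft_mulVec {n : A} (hn : D.lam n ≠ 0) :
    ptraceLeft (ketbra Φ Φ) *ᵥ (D.ψ n).ofLp = (D.lam n : ℂ) • (D.ψ n).ofLp := by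
  have h : (D.ψ n).ofLp ᵥ* (coeffMat Φ)ᴴ = (Real.sqrt (D.lam n) : ℂ) • star (D.φ n).ofLp := by
    have h1 := congrArg star (D.coeffMat_mulVec hn)
    rw [star_mulVec, star_star, star_smul, Complex.star_def, Complex.conj_ofReal] at h1
    exact h1
  rw [ptraceLeft_ketbra, mulVec_transpose, ← vecMul_vecMul, h, smul_vecMul, D.vecMul_coeffMat,
    smul_smul, D.sqrt_mul_sqrt]

/-- `τ_R^{-1/2} T†` maps `φₙ` to `λₙ^{-1/2} ψₙ` if `λₙ ≠ 0` and to `0` otherwise. -/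
theorem invSqrt_mul_isometry_mulVec (n : A) :
    (invSqrt (ptraceLeft (ketbra Φ Φ)) * D.isometryᴴ) *ᵥ (D.φ n).ofLp =
      ((Real.sqrt (D.lam n) : ℂ)⁻¹) • (D.ψ n).ofLp := by
  have h : D.isometryᴴ *ᵥ (D.φ n).ofLp = if D.lam n = 0 then 0 else (D.ψ n).ofLp := by
    rw [isometry, conjTranspose_sum, sum_mulVec, Finset.sum_eq_single n]
    · split_ifs with h0
      · simp
      · rw [conjTranspose_ketbra, ketbra_mulVec, star_dotProduct_basis, if_pos rfl, one_smul]
    · intro m _ hm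
      split_ifs with h0
      · simp
      · rw [conjTranspose_ketbra, ketbra_mulVec, star_dotProduct_basis, if_neg hm, zero_smul]
    · simp
  rw [← mulVec_mulVec, h]
  split_ifs with h0
  · simp [h0]
  · rw [invSqrt, cfc_mulVec_of_mulVec_eq (isHermitian_ptraceLeft_ketbra Φ) _
      (D.ptraceLeft_mulVec h0), Complex.ofReal_inv]

theorem supportProj_mulVec (n : A) :
    supportProj (ptraceRight (ketbra Φ Φ)) *ᵥ (D.φ n).ofLp =
      (if D.lam n = 0 then (0 : ℂ) else 1) • (D.φ n).ofLp := by
  have h : (ptraceRight (ketbra Φ Φ)).IsHermitian := by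
    rw [ptraceRight_ketbra]
    exact (posSemidef_self_mul_conjTranspose _).isHermitian
  rw [supportProj, cfc_mulVec_of_mulVec_eq h _ (D.ptraceRight_mulVec n)]
  split_ifs <;> simp

end SchmidtDecomposition

end Purification

/-! ### The canonical test -/

section Canonical

variable {A A' R : Type*} [Fintype A] [Fintype A'] [Fintype R] [DecidableEq A] [DecidableEq A']
  [DecidableEq R]

/-- The block of a bipartite operator at a pair of basis vectors of the first factor. -/
def block {X Y : Type*} (Ω : Matrix (A' × X) (A' × Y) ℂ) (x y : A') : Matrix X Y ℂ :=
  Matrix.of fun a b => Ω (x, a) (y, b)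

theorem block_kronecker_mul_mul {X Y Z W : Type*} [Fintype Y] [Fintype Z]
    (Ω : Matrix (A' × Y) (A' × Z) ℂ) (M : Matrix X Y ℂ) (N : Matrix Z W ℂ) (x y : A') :
    block (((1 : Matrix A' A' ℂ) ⊗ₖ M) * Ω * ((1 : Matrix A' A' ℂ) ⊗ₖ N)) x y =
      M * block Ω x y * N := by
  ext a b
  simp only [block, Matrix.of_apply, Matrix.mul_apply, Fintype.sum_prod_type, kroneckerMap_apply,
    Matrix.one_apply]
  rw [Finset.sum_eq_single y (fun c _ hc => by simp [hc]) (by simp)]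
  refine Finset.sum_congr rfl fun d _ => ?_
  rw [Finset.sum_eq_single x (fun c _ hc => by simp [Ne.symm hc]) (by simp)]
  simp

theorem block_partialTransposeIn (φ : OrthonormalBasis A ℂ (EuclideanSpace ℂ A))
    (Ω : Matrix (A' × A) (A' × A) ℂ) (x y : A') :
    block (partialTransposeIn φ Ω) x y =
      ∑ m, ∑ n, (star (φ n).ofLp ⬝ᵥ block Ω x y *ᵥ (φ m).ofLp) •
        ketbra (φ m).ofLp (φ n).ofLp := by
  have h : block (partialTransposeIn φ Ω) x y = ∑ m, ∑ n, block
      (((1 : Matrix A' A' ℂ) ⊗ₖ ketbra (φ m).ofLp (φ n).ofLp) * Ω *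
        ((1 : Matrix A' A' ℂ) ⊗ₖ ketbra (φ m).ofLp (φ n).ofLp)) x y := by
    ext a b
    simp [block, partialTransposeIn, Matrix.sum_apply]
  rw [h]
  refine Finset.sum_congr rfl fun m _ => Finset.sum_congr rfl fun n _ => ?_
  rw [block_kronecker_mul_mul, mul_assoc, mul_ketbra, mul_ketbra, ketbra_mulVec]
  ext a b
  simp [ketbra, vecMulVec_apply, mul_assoc]

theorem isHermitian_partialTransposeIn (φ : OrthonormalBasis A ℂ (EuclideanSpace ℂ A))
    {Ω : Matrix (A' × A) (A' × A) ℂ} (hΩ : Ω.IsHermitian) :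
    (partialTransposeIn φ Ω).IsHermitian := by
  rw [Matrix.IsHermitian, partialTransposeIn, conjTranspose_sum, Finset.sum_comm]
  simp only [conjTranspose_sum]
  rw [Finset.sum_comm]
  conv_rhs => rw [Finset.sum_comm]
  refine Finset.sum_congr rfl fun m _ => Finset.sum_congr rfl fun n _ => ?_
  rw [conjTranspose_mul, conjTranspose_mul, hΩ.eq, conjTranspose_kronecker, conjTranspose_one,
    conjTranspose_ketbra, mul_assoc]

theorem isHermitian_canonicalObservable {Ω : Matrix (A' × A) (A' × A) ℂ} (hΩ : Ω.IsHermitian)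
    {Φ : A × R → ℂ} (D : SchmidtDecomposition Φ) : (canonicalObservable Ω D).IsHermitian := by
  have h : (1 : Matrix A' A' ℂ) ⊗ₖ (D.isometry * invSqrt (ptraceLeft (ketbra Φ Φ))) =
      ((1 : Matrix A' A' ℂ) ⊗ₖ (invSqrt (ptraceLeft (ketbra Φ Φ)) * D.isometryᴴ))ᴴ := by
    rw [conjTranspose_kronecker, conjTranspose_one, conjTranspose_mul,
      conjTranspose_conjTranspose, (isHermitian_invSqrt _).eq]
  rw [canonicalObservable, h]
  exact isHermitian_mul_mul_conjTranspose _ (isHermitian_partialTransposeIn D.φ hΩ)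

theorem block_canonicalObservable (Ω : Matrix (A' × A) (A' × A) ℂ) {Φ : A × R → ℂ}
    (D : SchmidtDecomposition Φ) (x y : A') :
    block (canonicalObservable Ω D) x y =
      ∑ m, ∑ n, (star (D.φ n).ofLp ⬝ᵥ block Ω x y *ᵥ (D.φ m).ofLp) •
        ketbra ((Real.sqrt (D.lam m) : ℂ)⁻¹ • (D.ψ m).ofLp)
          ((Real.sqrt (D.lam n) : ℂ)⁻¹ • (D.ψ n).ofLp) := by
  have h : D.isometry * invSqrt (ptraceLeft (ketbra Φ Φ)) =
      (invSqrt (ptraceLeft (ketbra Φ Φ)) * D.isometryᴴ)ᴴ := by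
    rw [conjTranspose_mul, conjTranspose_conjTranspose, (isHermitian_invSqrt _).eq]
  rw [canonicalObservable, block_kronecker_mul_mul, block_partialTransposeIn, h, Matrix.mul_sum,
    Matrix.sum_mul]
  refine Finset.sum_congr rfl fun m _ => ?_
  rw [Matrix.mul_sum, Matrix.sum_mul]
  refine Finset.sum_congr rfl fun n _ => ?_
  rw [Matrix.mul_smul, Matrix.smul_mul, mul_ketbra_mul_conjTranspose,
    D.invSqrt_mul_isometry_mulVec, D.invSqrt_mul_isometry_mulVec]

theorem isHermitian_supportProj (τ : Matrix A A ℂ) : (supportProj τ).IsHermitian :=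
  isHermitian_cfc _ τ

/-- The complementary projection maps into the kernel of I ⊗ τ, which admissibility puts in the
kernel of Ω. -/
theorem mul_kronecker_supportProj {Ω : Matrix (A' × A) (A' × A) ℂ} {τ : Matrix A A ℂ}
    (hτ : τ ∈ admissibleStates Ω) : Ω * ((1 : Matrix A' A' ℂ) ⊗ₖ supportProj τ) = Ω := by
  have h : Ω * ((1 : Matrix A' A' ℂ) ⊗ₖ (1 - supportProj τ)) = 0 := by
    refine Matrix.ext_of_mulVec_single fun i => ?_
    rw [← mulVec_mulVec, hτ.2, zero_mulVec]
    rw [mulVec_mulVec, ← mul_kronecker_mul, mul_sub, mul_supportProj hτ.1.1, mul_one, mul_one, sub_self,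
      kronecker_zero, zero_mulVec]
  have h1 : (1 : Matrix A' A' ℂ) ⊗ₖ (1 - supportProj τ) =
      1 - (1 : Matrix A' A' ℂ) ⊗ₖ supportProj τ := by
    rw [eq_sub_iff_add_eq, ← kronecker_add, sub_add_cancel, one_kronecker_one]
  rw [h1, mul_sub, mul_one, sub_eq_zero] at h
  exact h.symm

theorem kronecker_supportProj_mul_mul {Ω : Matrix (A' × A) (A' × A) ℂ} (hΩ : Ω.IsHermitian)
    {τ : Matrix A A ℂ} (hτ : τ ∈ admissibleStates Ω) :
    ((1 : Matrix A' A' ℂ) ⊗ₖ supportProj τ) * Ω * ((1 : Matrix A' A' ℂ) ⊗ₖ supportProj τ) = Ω := by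
  have h := congrArg conjTranspose (mul_kronecker_supportProj hτ)
  rw [conjTranspose_mul, hΩ.eq, conjTranspose_kronecker, conjTranspose_one,
    (isHermitian_supportProj τ).eq] at h
  rw [h, mul_kronecker_supportProj hτ]

theorem Test.IsCanonical.marginal_eq {T : Test A A' R} {Ω : Matrix (A' × A) (A' × A) ℂ}
    {τ : Matrix A A ℂ} {Φ : A × R → ℂ} (h : T.IsCanonical Ω τ Φ) : T.marginal = τ := by
  rw [Test.marginal, h.2.1]
  exact h.1

/-- Each block of the performance operator is M Oᵀ M†, with M the coefficient matrix of Φ. The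
transpose here undoes the partial transpose in the observable, and M undoes the factors λₙ^{-1/2}:
it sends the conjugate of λₙ^{-1/2} ψₙ to φₙ. What remains is Ω compressed to the support of τ,
which is Ω by admissibility. -/
theorem Test.IsCanonical.performanceOp_eq {T : Test A A' R} {Ω : Matrix (A' × A) (A' × A) ℂ}
    (hΩ : Ω.IsHermitian) {τ : Matrix A A ℂ} (hτ : τ ∈ admissibleStates Ω) {Φ : A × R → ℂ}
    (h : T.IsCanonical Ω τ Φ) : T.performanceOp = Ω := by
  obtain ⟨hP, hσ, D, hO⟩ := h
  conv_rhs => rw [← kronecker_supportProj_mul_mul hΩ hτ]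
  ext ⟨x, a⟩ ⟨y, b⟩
  have hR : (((1 : Matrix A' A' ℂ) ⊗ₖ supportProj τ) * Ω *
      ((1 : Matrix A' A' ℂ) ⊗ₖ supportProj τ)) (x, a) (y, b) =
      (supportProj τ * block Ω x y * supportProj τ) a b := by
    rw [← block_kronecker_mul_mul]
    rfl
  let p : A → A → ℂ := fun n => (if D.lam n = 0 then (0 : ℂ) else 1) • (D.φ n).ofLp
  have hproj : supportProj τ = ∑ n, ketbra (p n) (D.φ n).ofLp := by
    conv_lhs => rw [eq_sum_mulVec_ketbra D.φ (supportProj τ), ← hP]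
    exact Finset.sum_congr rfl fun n _ => by rw [D.supportProj_mulVec]
  have hproj' : supportProj τ = ∑ n, ketbra (D.φ n).ofLp (p n) := by
    rw [← (isHermitian_supportProj τ).eq, hproj, conjTranspose_sum]
    exact Finset.sum_congr rfl fun n _ => conjTranspose_ketbra _ _
  have hL : T.performanceOp (x, a) (y, b) =
      (coeffMat Φ * (block T.O x y)ᵀ * (coeffMat Φ)ᴴ) a b := by
    rw [T.performanceOp_apply, hσ]
    simp only [ketbra, vecMulVec_apply, Matrix.mul_apply, coeffMat, block, transpose_apply,
      conjTranspose_apply, Matrix.of_apply, Pi.star_apply, Finset.sum_mul]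
    exact Finset.sum_congr rfl fun r _ => Finset.sum_congr rfl fun s _ => by ring
  have hχ : ∀ n, coeffMat Φ *ᵥ star ((Real.sqrt (D.lam n) : ℂ)⁻¹ • (D.ψ n).ofLp) =
      p n := by
    intro n
    simp only [p]
    split_ifs with h0
    · simp [h0]
    · have h1 : (Real.sqrt (D.lam n) : ℂ) ≠ 0 := by
        exact_mod_cast Real.sqrt_ne_zero'.mpr (lt_of_le_of_ne (D.lam_nonneg n) (Ne.symm h0))
      rw [star_smul, mulVec_smul, D.coeffMat_mulVec h0, smul_smul, star_inv₀, Complex.star_def,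
        Complex.conj_ofReal, inv_mul_cancel₀ h1]
  have hright : supportProj τ * block Ω x y * supportProj τ =
      ∑ m, ∑ n, (star (D.φ n).ofLp ⬝ᵥ block Ω x y *ᵥ (D.φ m).ofLp) • ketbra (p n) (p m) := by
    conv_lhs => rw [mul_assoc]
    conv_lhs => lhs; rw [hproj]
    conv_lhs => rhs; rhs; rw [hproj']
    rw [Matrix.mul_sum, Matrix.mul_sum]
    refine Finset.sum_congr rfl fun m _ => ?_
    rw [Matrix.sum_mul]
    refine Finset.sum_congr rfl fun n _ => ?_
    rw [mul_ketbra, mul_ketbra, ketbra_mulVec, ketbra, smul_vecMulVec, ketbra]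
  have hleft : coeffMat Φ * (block T.O x y)ᵀ * (coeffMat Φ)ᴴ =
      ∑ m, ∑ n, (star (D.φ n).ofLp ⬝ᵥ block Ω x y *ᵥ (D.φ m).ofLp) • ketbra (p n) (p m) := by
    rw [hO, block_canonicalObservable, transpose_sum, Matrix.mul_sum, Matrix.sum_mul]
    refine Finset.sum_congr rfl fun m _ => ?_
    rw [transpose_sum, Matrix.mul_sum, Matrix.sum_mul]
    refine Finset.sum_congr rfl fun n _ => ?_
    have ht : ∀ v w : R → ℂ, (ketbra v w)ᵀ = ketbra (star w) (star v) := by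
      intro v w
      rw [ketbra, ketbra, star_star, transpose_vecMulVec]
    rw [transpose_smul, Matrix.mul_smul, Matrix.smul_mul, ht, mul_ketbra_mul_conjTranspose, hχ, hχ]
  rw [hL, hR, hleft, hright]

theorem exists_isCanonical {Ω : Matrix (A' × A) (A' × A) ℂ} (hΩ : Ω.IsHermitian)
    {τ : Matrix A A ℂ} (hτ : IsState τ) {Φ : A × R → ℂ} (hΦ : IsPurification Φ τ) :
    ∃ T : Test A A' R, T.IsCanonical Ω τ Φ := by
  obtain ⟨D⟩ := nonempty_schmidtDecomposition Φ
  refine ⟨⟨ketbra Φ Φ, canonicalObservable Ω D, ⟨posSemidef_ketbra Φ, ?_⟩,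
    isHermitian_canonicalObservable hΩ D⟩, hΦ, rfl, D, rfl⟩
  rw [← trace_ptraceRight, hΦ]
  exact hτ.2

end Canonical

/-! ### Shifting the observable -/

section Shift

variable {A A' R : Type*} [Fintype A] [Fintype A'] [Fintype R] [DecidableEq A] [DecidableEq A']
  [DecidableEq R]

/-- This is the compression of K along v ↦ v ⊗ ∑ e_r. -/
theorem posSemidef_sum_blocks {X : Type*} [Fintype X] {K : Matrix (X × R) (X × R) ℂ}
    (hK : K.PosSemidef) :
    (Matrix.of fun x y => ∑ r, ∑ s, K (x, r) (y, s)).PosSemidef := by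
  refine PosSemidef.of_dotProduct_mulVec_nonneg ?_ fun v => ?_
  · ext x y
    simp only [conjTranspose_apply, Matrix.of_apply, star_sum, hK.isHermitian.apply]
    exact Finset.sum_comm
  · refine (hK.dotProduct_mulVec_nonneg fun p => v p.1).trans_eq ?_
    simp only [dotProduct, mulVec, Fintype.sum_prod_type, Pi.star_apply, Matrix.of_apply,
      Finset.mul_sum, Finset.sum_mul]
    refine Finset.sum_congr rfl fun x _ => ?_
    rw [Finset.sum_comm]

/-- The partial transpose of Ω is a compression of the positive operator O ⊗ σᵀ, restricted to equal
indices for the two copies of R. -/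
theorem Test.isPPT_performanceOp (T : Test A A' R) (hO : T.O.PosSemidef) :
    IsPPT T.performanceOp := by
  have hK := (hO.kronecker T.isState.1.transpose).submatrix
    fun p : (A' × A) × R => ((p.1.1, p.2), (p.1.2, p.2))
  have h : partialTranspose T.performanceOp = Matrix.of fun x y => ∑ r, ∑ s,
      (T.O ⊗ₖ T.σᵀ).submatrix (fun p : (A' × A) × R => ((p.1.1, p.2), (p.1.2, p.2)))
        (fun p : (A' × A) × R => ((p.1.1, p.2), (p.1.2, p.2))) (x, r) (y, s) := by
    ext x y
    simp [partialTranspose, T.performanceOp_apply, kroneckerMap_apply]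
  rw [IsPPT, h]
  exact posSemidef_sum_blocks hK

theorem posSemidef_add_opNorm {n : Type*} [Fintype n] [DecidableEq n] {M : Matrix n n ℂ}
    (hM : M.IsHermitian) : (M + (opNorm M : ℂ) • (1 : Matrix n n ℂ)).PosSemidef := by
  refine posSemidef_of_re_nonneg (hM.add (by simp [Matrix.IsHermitian])) fun v => ?_
  set x : EuclideanSpace ℂ n := WithLp.toLp 2 v with hx
  have h1 : star v ⬝ᵥ M *ᵥ v = inner ℂ x (Matrix.toEuclideanCLM (𝕜 := ℂ) M x) := by
    rw [inner_eq_star_dotProduct']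
    rfl
  have h2 : ‖inner ℂ x (Matrix.toEuclideanCLM (𝕜 := ℂ) M x)‖ ≤ ‖x‖ * (opNorm M * ‖x‖) :=
    (norm_inner_le_norm _ _).trans (by gcongr; exact ContinuousLinearMap.le_opNorm _ _)
  have h3 := (abs_le.mp ((Complex.abs_re_le_norm _).trans h2)).1
  have h4 : (star v ⬝ᵥ v).re = ‖x‖ ^ 2 := re_star_dotProduct_self x
  rw [add_mulVec, dotProduct_add, Complex.add_re, h1, smul_mulVec, one_mulVec, dotProduct_smul,
    smul_eq_mul, Complex.re_ofReal_mul, h4]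
  nlinarith

theorem Test.trace_marginal (T : Test A A' R) : T.marginal.trace = 1 := by
  rw [Test.marginal, trace_ptraceRight, T.isState.2]

theorem Test.isState_marginal (T : Test A A' R) : IsState T.marginal := by
  refine ⟨?_, T.trace_marginal⟩
  have h : T.marginal = ∑ r, T.σ.submatrix (fun a => (a, r)) (fun a => (a, r)) := by
    ext a b
    simp [Test.marginal, ptraceRight, Matrix.sum_apply]
  rw [h]
  exact posSemidef_sum _ fun r _ => T.isState.1.submatrix _

theorem Test.detScore_shift (T : Test A A' R) (c : ℝ) {C : Matrix A A ℂ →ₗ[ℂ] Matrix A' A' ℂ}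
    (hC : IsChannel C) : (T.shift c).detScore C = T.detScore C + c := by
  have h : (applyFst C T.σ).trace = 1 := by
    rw [trace_applyFst, hC.2]
    exact T.trace_marginal
  simp only [Test.detScore, Test.shift]
  rw [add_mul, trace_add, smul_mul_assoc, one_mul, trace_smul, h]
  simp

end Shift

/-! ### Bounds and simulation for measure-and-prepare devices -/

section MeasurePrepare

variable {A A' R : Type*} [Fintype A] [Fintype A'] [Fintype R] [DecidableEq A] [DecidableEq A']
  [DecidableEq R]

/-- The map that measures `P` and prepares `ρ j` on outcome `j`. -/
def measurePrepare {k : ℕ} (P : Fin k → Matrix A A ℂ) (ρ : Fin k → Matrix A' A' ℂ) :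
    Matrix A A ℂ →ₗ[ℂ] Matrix A' A' ℂ :=
  ∑ j, ((Matrix.traceLinearMap A ℂ ℂ).comp (LinearMap.mulLeft ℂ (P j))).smulRight (ρ j)

theorem measurePrepare_apply {k : ℕ} (P : Fin k → Matrix A A ℂ) (ρ : Fin k → Matrix A' A' ℂ)
    (X : Matrix A A ℂ) : measurePrepare P ρ X = ∑ j, (P j * X).trace • ρ j := by
  simp [measurePrepare]

theorem trace_measurePrepare {C : Matrix A A ℂ →ₗ[ℂ] Matrix A' A' ℂ} {k : ℕ}
    {P : Fin k → Matrix A A ℂ} {ρ : Fin k → Matrix A' A' ℂ} (hρ : ∀ j, IsState (ρ j))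
    (hC : ∀ X, C X = ∑ j, (P j * X).trace • ρ j) (X : Matrix A A ℂ) :
    (C X).trace = (X * ∑ j, P j).trace := by
  rw [hC, trace_sum, Matrix.mul_sum, trace_sum]
  refine Finset.sum_congr rfl fun j _ => ?_
  rw [trace_smul, (hρ j).2, smul_eq_mul, mul_one, trace_mul_comm]

theorem Dominates.choiScore_le {Y : Matrix A A ℂ} {Ω : Matrix (A' × A) (A' × A) ℂ}
    (h : Dominates Y Ω) {C : Matrix A A ℂ →ₗ[ℂ] Matrix A' A' ℂ} {k : ℕ}
    {P : Fin k → Matrix A A ℂ} {ρ : Fin k → Matrix A' A' ℂ} (hP : ∀ j, (P j).PosSemidef)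
    (hρ : ∀ j, IsState (ρ j)) (hC : ∀ X, C X = ∑ j, (P j * X).trace • ρ j) :
    (choiScore Ω C).re ≤ ((Y * ∑ j, P j).trace).re := by
  rw [choiScore_measurePrepare Ω C P ρ hC, Complex.re_sum, Matrix.mul_sum, trace_sum,
    Complex.re_sum]
  refine Finset.sum_le_sum fun j _ => ?_
  have h1 := h.trace_mul_kronecker_le (hρ j).1 (hP j)
  rwa [(hρ j).2, Complex.one_re, one_mul] at h1

/-- Because the dominating operator is a multiple of the marginal, the bound on the unnormalized
score is S times the success probability, and the probability cancels. -/
theorem Test.probScore_le (T : Test A A' R) {S : ℝ}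
    (h : Dominates (S • T.marginal) T.performanceOp) {C : Matrix A A ℂ →ₗ[ℂ] Matrix A' A' ℂ}
    (hC : IsMPOperation C) (hpos : 0 < T.successProb C) : T.probScore C ≤ S := by
  obtain ⟨k, P, ρ, hP, -, hρ, hCX⟩ := hC
  rw [T.probScore_eq, div_le_iff₀ hpos, T.successProb_eq, trace_measurePrepare hρ hCX]
  refine (h.choiScore_le hP hρ hCX).trans_eq ?_
  rw [smul_mul_assoc, trace_smul, Complex.smul_re, smul_eq_mul]

/-- A measure-and-prepare channel can be simulated with any success probability without changing
the score. -/
theorem Test.mem_mpProbScores (T : Test A A' R) {S : ℝ} {k : ℕ} {P : Fin k → Matrix A A ℂ}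
    {ρ : Fin k → Matrix A' A' ℂ} (hP : ∀ j, (P j).PosSemidef) (hsum : ∑ j, P j = 1)
    (hρ : ∀ j, IsState (ρ j)) (hS : (∑ j, (T.performanceOp * (ρ j ⊗ₖ P j)).trace).re = S)
    {p : ℝ} (hp : 0 < p) (hp1 : p ≤ 1) : S ∈ T.mpProbScores p := by
  have hC := measurePrepare_apply (fun j => (p : ℂ) • P j) ρ
  have hsum' : ∑ j, (p : ℂ) • P j = (p : ℂ) • (1 : Matrix A A ℂ) := by
    rw [← Finset.smul_sum, hsum]
  have hsucc : T.successProb (measurePrepare (fun j => (p : ℂ) • P j) ρ) = p := by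
    rw [T.successProb_eq, trace_measurePrepare hρ hC, hsum', mul_smul_comm, mul_one, trace_smul,
      T.trace_marginal]
    simp
  refine ⟨measurePrepare (fun j => (p : ℂ) • P j) ρ, ⟨k, fun j => (p : ℂ) • P j, ρ, fun j => ?_,
    ?_, hρ, hC⟩, hsucc, ?_⟩
  · exact (hP j).smul (by exact_mod_cast hp.le)
  · have h : 1 - (p : ℂ) • (1 : Matrix A A ℂ) = ((1 - p : ℝ) : ℂ) • 1 := by
      rw [Complex.ofReal_sub, sub_smul, Complex.ofReal_one, one_smul]
    rw [hsum', h]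
    exact PosSemidef.one.smul (by exact_mod_cast sub_nonneg.mpr hp1)
  · rw [T.probScore_eq, hsucc, choiScore_measurePrepare _ _ _ _ hC, ← hS]
    have h : ∀ j, (T.performanceOp * (ρ j ⊗ₖ ((p : ℂ) • P j))).trace =
        (p : ℂ) * (T.performanceOp * (ρ j ⊗ₖ P j)).trace := by
      intro j
      rw [Matrix.kronecker_smul, mul_smul_comm, trace_smul, smul_eq_mul]
    simp only [h]
    rw [← Finset.mul_sum, Complex.re_ofReal_mul, mul_div_cancel_left₀ _ hp.ne']

end MeasurePrepare

end QuantumBenchmark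

end

theorem theorem3 {A A' R : Type*} [Fintype A] [DecidableEq A] [Fintype A'] [DecidableEq A']
    [Nonempty A'] [Fintype R] [DecidableEq R] (T : QuantumBenchmark.Test A A' R) :
    -- replacing `O` by `O + ‖O‖ I` shifts the scores by a constant and gives a PPT test
    (QuantumBenchmark.IsPPT (T.shift (QuantumBenchmark.opNorm T.O)).performanceOp ∧
      ∀ C : Matrix A A ℂ →ₗ[ℂ] Matrix A' A' ℂ, QuantumBenchmark.IsChannel C →
        (T.shift (QuantumBenchmark.opNorm T.O)).detScore C =
          T.detScore C + QuantumBenchmark.opNorm T.O) ∧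
    -- construction of the fully black box test
    (QuantumBenchmark.IsPPT T.performanceOp →
      ∃ S : ℝ,
        -- `S` is the deterministic benchmark
        IsGreatest T.mpDetScores S ∧
        -- there is a minimizer, and every minimizer does the job
        (∃ τ, QuantumBenchmark.IsMinimizer T.performanceOp τ) ∧
        ∀ τ, QuantumBenchmark.IsMinimizer T.performanceOp τ →
          QuantumBenchmark.benchmarkFun T.performanceOp τ = S ∧
          -- canonical tests exist, already with a copy of `A` as reference system
          (∃ (Φ : A × A → ℂ) (T' : QuantumBenchmark.Test A A' A),
            T'.IsCanonical T.performanceOp τ Φ) ∧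
          ∀ {R' : Type*} [Fintype R'] [DecidableEq R'] (Φ : A × R' → ℂ),
            -- they exist for every purification of `τ`
            (QuantumBenchmark.IsPurification Φ τ →
              ∃ T' : QuantumBenchmark.Test A A' R', T'.IsCanonical T.performanceOp τ Φ) ∧
            ∀ T' : QuantumBenchmark.Test A A' R', T'.IsCanonical T.performanceOp τ Φ →
              T'.performanceOp = T.performanceOp ∧
              T'.marginal = τ ∧
              (∀ C : Matrix A A ℂ →ₗ[ℂ] Matrix A' A' ℂ, QuantumBenchmark.IsChannel C →
                T'.detScore C = T.detScore C) ∧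
              IsGreatest T'.mpProbScoresAll S ∧
              ∀ p : ℝ, 0 < p → p ≤ 1 → IsGreatest (T'.mpProbScores p) S) := by
  open QuantumBenchmark in
  refine ⟨⟨(T.shift (opNorm T.O)).isPPT_performanceOp (posSemidef_add_opNorm T.isHermitian),
    fun C hC => T.detScore_shift _ hC⟩, fun hΩ => ?_⟩
  have hH := T.isHermitian_performanceOp
  have : Nonempty A := by
    by_contra hA
    rw [not_nonempty_iff] at hA
    have h := T.trace_marginal
    simp [Matrix.trace] at h
  obtain ⟨S, ⟨k, P, ρ, hP, hsum, hρ, hS⟩, hdual⟩ :=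
    QuantumBenchmark.exists_measurePrepare_and_dominates T.performanceOp
  obtain ⟨Y, hY, hYd, hYt⟩ := QuantumBenchmark.exists_posSemidef_dominates_trace_le hΩ hdual
  have hC := QuantumBenchmark.measurePrepare_apply P ρ
  have hscore : (QuantumBenchmark.choiScore T.performanceOp
      (QuantumBenchmark.measurePrepare P ρ)).re = S := by
    rw [QuantumBenchmark.choiScore_measurePrepare _ _ _ _ hC, hS]
  -- Weak duality against the optimal strategy.
  have hweak : ∀ Z, QuantumBenchmark.Dominates Z T.performanceOp → S ≤ (Z.trace).re := by
    intro Z hZ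
    have h := hZ.choiScore_le hP hρ hC
    rwa [hscore, hsum, mul_one] at h
  have hYS : (Y.trace).re = S := le_antisymm hYt (hweak Y hYd)
  have hYim : (Y.trace).im = 0 := (Complex.le_def.mp hY.trace_nonneg).2.symm
  have hS0 : 0 ≤ S := hYS ▸ (Complex.le_def.mp hY.trace_nonneg).1
  have hYtr : Y.trace = (S : ℂ) := Complex.ext hYS hYim
  have hmin : ∀ τ ∈ QuantumBenchmark.admissibleStates T.performanceOp,
      S ≤ QuantumBenchmark.benchmarkFun T.performanceOp τ := by
    intro τ hτ
    have h := hweak _ (QuantumBenchmark.dominates_benchmarkFun hH hτ)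
    rw [Matrix.trace_smul, hτ.1.2] at h
    simpa using h
  -- If S = 0, then Y is positive with trace 0, hence 0, and any state serves; the marginal input
  -- state is one at hand.
  obtain ⟨τ₀, hτ₀, hYτ⟩ : ∃ τ₀, QuantumBenchmark.IsState τ₀ ∧ S • τ₀ = Y := by
    by_cases h0 : S = 0
    · refine ⟨T.marginal, T.isState_marginal, ?_⟩
      rw [h0, Complex.ofReal_zero] at hYtr
      rw [h0, zero_smul, hY.trace_eq_zero_iff.mp hYtr]
    · refine ⟨S⁻¹ • Y, ⟨?_, ?_⟩, by rw [smul_smul, mul_inv_cancel₀ h0, one_smul]⟩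
      · have h := hY.smul (a := ((S⁻¹ : ℝ) : ℂ)) (by exact_mod_cast inv_nonneg.mpr hS0)
        rwa [Complex.coe_smul] at h
      · rw [Matrix.trace_smul, hYtr, Complex.real_smul, ← Complex.ofReal_mul, inv_mul_cancel₀ h0,
          Complex.ofReal_one]
  have hτ₀d : QuantumBenchmark.Dominates (S • τ₀) T.performanceOp := by rwa [hYτ]
  have hτ₀a := QuantumBenchmark.mem_admissibleStates_of_dominates hH hΩ hτ₀ hτ₀d
  have hτ₀f := QuantumBenchmark.benchmarkFun_le_of_dominates hτ₀.1 hS0 hτ₀d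
  refine ⟨S, ⟨⟨QuantumBenchmark.measurePrepare P ρ, ⟨k, P, ρ, hP, hsum, hρ, hC⟩, ?_⟩, ?_⟩,
    ⟨τ₀, hτ₀a, fun τ hτ => hτ₀f.trans (hmin τ hτ)⟩, fun τ hτ => ?_⟩
  · rw [T.detScore_eq, hscore]
  · rintro s ⟨C, ⟨k', P', ρ', hP', hsum', hρ', hC'⟩, rfl⟩
    have h := hYd.choiScore_le hP' hρ' hC'
    rwa [hsum', mul_one, hYS, ← T.detScore_eq] at h
  have hτS : QuantumBenchmark.benchmarkFun T.performanceOp τ = S :=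
    le_antisymm ((hτ.2 τ₀ hτ₀a).trans hτ₀f) (hmin τ hτ.1)
  have hτd : QuantumBenchmark.Dominates (S • τ) T.performanceOp :=
    hτS ▸ QuantumBenchmark.dominates_benchmarkFun hH hτ.1
  refine ⟨hτS, ?_, fun Φ => ⟨QuantumBenchmark.exists_isCanonical hH hτ.1.1, fun T' hT' => ?_⟩⟩
  · obtain ⟨Φ, hΦ⟩ := QuantumBenchmark.exists_isPurification hτ.1.1.1
    obtain ⟨T', hT'⟩ := QuantumBenchmark.exists_isCanonical hH hτ.1.1 hΦ
    exact ⟨Φ, T', hT'⟩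
  have hperf := hT'.performanceOp_eq hH hτ.1
  have hmarg := hT'.marginal_eq
  -- Both tests have the same Ω, so the strategy optimal for the original test is reused.
  have hmem : ∀ p : ℝ, 0 < p → p ≤ 1 → S ∈ T'.mpProbScores p := fun p hp hp1 =>
    T'.mem_mpProbScores hP hsum hρ (hperf ▸ hS) hp hp1
  have hle : ∀ C, QuantumBenchmark.IsMPOperation C → 0 < T'.successProb C →
      T'.probScore C ≤ S := fun C hC hpos =>
    T'.probScore_le (by rwa [hperf, hmarg]) hC hpos
  refine ⟨hperf, hmarg, fun C _ => ?_, ⟨?_, ?_⟩, fun p hp hp1 => ⟨hmem p hp hp1, ?_⟩⟩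
  · rw [T'.detScore_eq, T.detScore_eq, hperf]
  · obtain ⟨C, hC, hp, hs⟩ := hmem 1 one_pos le_rfl
    exact ⟨C, hC, hp ▸ one_pos, hs⟩
  · rintro s ⟨C, hC, hp, rfl⟩
    exact hle C hC hp
  · rintro s ⟨C, hC, hp', rfl⟩
    exact hle C hC (hp' ▸ hp)
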